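/- Let $T$ be a rooted tree in which every vertex has infinitely many children. Let $B_0$ be the set of vertices at even distance from the root (the root and the vertices on alternating levels), and direct each edge of $T$ towards its end in $B_0$. Call a set $I$ of vertices linkable if there is a set of pairwise vertex-disjoint finite directed paths (trivial paths allowed), each ending in $B_0$, whose set of initial vertices is $I$; let $M_L(T,B_0)$ be the pair consisting of $V(T)$ and the family of linkable sets. More generally $M_L(D,B)$ is defined in the same way for any loopless digraph $D$ and any set $B$ of sinks of $D$, and a strict gammoid is a (possibly infinite) matroid isomorphic to some $M_L(D,B)$. Then $M_L(T,B_0)$ is a matroid, hence a strict gammoid, and it is not dual to any path-transversal matroid: its dual is not isomorphic to $M_{PT}(G,m_0)$ for any bipartite graph $G$ with vertex classes $V,W$ and any matching $m_0$ of $G$ that covers $W$. Here $M_{PT}(G,m_0)$ is the pair consisting of $V$ and the family of those $I\subseteq V$ for which there is a matching $m$ of $G$ that covers, in $V$, exactly $I$, and such that all connected components of the graph with edge set $m_0\cup m$ are finite. In particular, there is a strict gammoid whose dual is not a path-transversal matroid. -/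

import Mathlib

universe u v w

/-- A dimaze: a digraph without loops on the vertex set `V`, together with a set of sinks,
called the exits. -/
structure Dimaze (V : Type*) where
  digraph : Digraph V
  loopless : ∀ v, ¬ digraph.Adj v v
  exits : Set V
  exits_are_sinks : ∀ b ∈ exits, ∀ v, ¬ digraph.Adj b v

/-- A finite directed path of a dimaze, as the nonempty list of its (pairwise distinct) vertices. -/
structure Dimaze.Path {V : Type*} (D : Dimaze V) where
  verts : List V
  ne_nil : verts ≠ []
  chain : verts.IsChain D.digraph.Adj
  nodup : verts.Nodup

namespace Dimaze

variable {V : Type*} {D : Dimaze V}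

/-- The initial vertex of a path. -/
def Path.ini (P : D.Path) : V := P.verts.head P.ne_nil

/-- The terminal vertex of a path. -/
def Path.ter (P : D.Path) : V := P.verts.getLast P.ne_nil

/-- The vertex set of a path. -/
def Path.support (P : D.Path) : Set V := {v | v ∈ P.verts}

variable (D)

/-- A linkage is a set of pairwise vertex-disjoint (finite) paths ending in the exits. -/
def IsLinkage (Ps : Set D.Path) : Prop :=
  (∀ P ∈ Ps, P.ter ∈ D.exits) ∧ Ps.PairwiseDisjoint Path.support

/-- A set is linkable if it is the set of initial vertices of a linkage. -/
def Linkable (A : Set V) : Prop :=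
  ∃ Ps : Set D.Path, D.IsLinkage Ps ∧ Path.ini '' Ps = A

/-- `M` is `M_L(D)`: the ground set is the whole vertex set, and the independent sets are exactly
the linkable sets. -/
def IsLinkabilityMatroid (M : Matroid V) : Prop :=
  M.E = Set.univ ∧ ∀ I : Set V, M.Indep I ↔ D.Linkable I

end Dimaze

/-- The matroid `M` is isomorphic to the set system consisting of the ground set `V` and of the
sets that satisfy `Ind`. -/
def Matroid.IsoSetSystem {α V : Type*} (M : Matroid α) (Ind : Set V → Prop) : Prop :=
  ∃ e : M.E ≃ V, ∀ I : Set M.E, M.Indep (Subtype.val '' I) ↔ Ind (e '' I)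

/-- A strict gammoid is a matroid isomorphic to `M_L(D)` for some dimaze `D`. -/
def Matroid.IsStrictGammoid {α : Type u} (M : Matroid α) : Prop :=
  ∃ (V : Type u) (D : Dimaze V), M.IsoSetSystem D.Linkable

/-- A set of edges between the left class `V` and the right class `W` is independent if no two of
its members share a vertex. -/
def NoSharedVertex {V W : Type*} (m : Set (V × W)) : Prop :=
  ∀ e ∈ m, ∀ f ∈ m, (e.1 = f.1 ∨ e.2 = f.2) → e = f

/-- A bimaze: a bipartite graph with left class `V` and right class `W`, together with
an identity matching, i.e. a matching that covers `W`. -/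
structure Bimaze (V W : Type*) where
  edges : Set (V × W)
  idMatching : Set (V × W)
  idMatching_subset : idMatching ⊆ edges
  idMatching_noShared : NoSharedVertex idMatching
  idMatching_onto : Prod.snd '' idMatching = Set.univ

/-- The graph on `V ⊕ W` with the given set of edges between `V` and `W`. -/
def bipartiteGraph {V W : Type*} (E : Set (V × W)) : SimpleGraph (V ⊕ W) :=
  SimpleGraph.fromRel fun x y => ∃ e ∈ E, x = Sum.inl e.1 ∧ y = Sum.inr e.2

namespace Bimaze

variable {V W : Type*} (G : Bimaze V W)

/-- A matching of the bipartite graph. -/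
def IsMatching (m : Set (V × W)) : Prop := m ⊆ G.edges ∧ NoSharedVertex m

/-- An `m₀`-matching: a matching `m` such that all components of the subgraph with edge set
`m₀ ∪ m` are finite, `m₀` being the identity matching. (Here this subgraph also has the vertices
that lie on no edge of `m₀ ∪ m`; they only add components with one vertex.) -/
def IsIdMatching (m : Set (V × W)) : Prop :=
  G.IsMatching m ∧ ∀ c : (bipartiteGraph (G.idMatching ∪ m)).ConnectedComponent, c.supp.Finite

/-- A set of left vertices is `m₀`-matchable if it is the set of left vertices covered by some
`m₀`-matching. -/
def IdMatchable (I : Set V) : Prop := ∃ m : Set (V × W), G.IsIdMatching m ∧ Prod.fst '' m = I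

end Bimaze

/-- A path-transversal matroid is a matroid (isomorphic to one) whose independent sets are the
`m₀`-matchable sets of left vertices of a bimaze with identity matching `m₀`. -/
def Matroid.IsPathTransversal {α : Type u} (M : Matroid α) : Prop :=
  ∃ (V : Type v) (W : Type w) (G : Bimaze V W), M.IsoSetSystem G.IdMatchable

/-- The children of `v` in the tree `T` with root `r`. -/
def SimpleGraph.children {V : Type*} (T : SimpleGraph V) (r v : V) : Set V :=
  {w | T.Adj v w ∧ T.dist r w = T.dist r v + 1}

/-- The root and the vertices on alternating levels of the tree `T` with root `r`. -/
def SimpleGraph.evenLevels {V : Type*} (T : SimpleGraph V) (r : V) : Set V :=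
  {v | Even (T.dist r v)}

/-- In a tree, each edge has exactly one end on the even levels. -/
theorem SimpleGraph.IsTree.mem_evenLevels_iff_of_adj {V : Type*} {T : SimpleGraph V}
    (hT : T.IsTree) (r : V) {u v : V} (h : T.Adj u v) :
    u ∈ T.evenLevels r ↔ v ∉ T.evenLevels r := by
  have h1 := hT.dist_ne_of_adj r h
  have h2 := h.diff_dist_adj (u := r)
  simp only [SimpleGraph.evenLevels, Set.mem_ofPred_eq, Nat.even_iff]
  omega

/-- The dimaze obtained from the tree `T` with root `r` by taking the even levels as the exits and
directing each edge towards its end among the exits. -/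
def SimpleGraph.treeDimaze {V : Type*} (T : SimpleGraph V) (r : V) : Dimaze V where
  digraph := { Adj := fun u v => T.Adj u v ∧ u ∉ T.evenLevels r ∧ v ∈ T.evenLevels r }
  loopless := fun _ h => h.2.1 h.2.2
  exits := T.evenLevels r
  exits_are_sinks := fun _ hb _ h => h.2.1 hb

/-!
In the dimaze of the tree `T` a path is either trivial or a single edge from an odd to an even
level. So a set is linkable if and only if it can be matched injectively into the even levels,
where vertices on even levels are matched to themselves and vertices on odd levels to a neighbour
(`SimpleGraph.treeDimaze_linkable_iff`). The tree is used only through its parent function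
(`ParentTree`).

**The linkable sets form a matroid.** The augmentation axiom holds for matchings along any
relation, by following one alternating path (`MatchableAlong.exists_insert_of_not_maximal`). For
the existence of maximal linkable sets between `I` and `X`, call a vertex saturated by a set `Y`
if the part of `Y` in its subtree forces it to be linked to its parent (odd levels), respectively
to be covered from below (even levels). This is a least fixed point (`ParentTree.Full`): the
circuits of the matroid are rayless. A maximal set is built from the root downwards. At each
vertex it is decided whether the set saturates it, where everything saturated by `I` has to be
saturated and only what is saturated by `X` can be. Whenever there is a choice of the child by
which a vertex is saturated, one of least ordinal rank is taken, so that saturation is never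
deferred along an infinite path. The result is maximal: a larger linkable set would force a link
from a vertex on an odd level to its parent, which forces another one two levels higher up, and
this has to stop at the root (`ParentTree.Choices.base_maximal`).

**The dual is not path-transversal.** Let the dual be `M_PT(G, m₀)`. The vertices that `m₀` covers
form a base of it, as alternating paths in finite components end
(`Bimaze.IdMatchable.exists_reachable`). Let `U` be the complementary base of the matroid of the
tree, and `f` a linking of `U`. As all vertices have several children, there is a path
`b 0, a 0, b 1, a 1, …` that descends from the root and alternates with respect to `f`. For each `b n ∈ U`
there is an element `entering n` outside `U`, near `a n`, that can replace `b n` but, lying deeper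
in the tree, cannot replace `b j` for `j < n`. In `G` these exchanges are given by finite
alternating paths. Since the exchanges are triangular, the paths are disjoint, so they can be
carried out all at once with finite components (`Bimaze.idMatchable_exchange`), and the result is
independent in the dual. In the tree, however, exchanging all these elements gives a set that does
not span: linking each `a n` to `b (n + 1)` frees the root
(`ParentTree.AlternatingRay.insert_root_exchange_matchable`).
-/

/-! ### Matchings along a relation -/

/-- A set `J` can be matched along `P` if there is an injective choice, for every `x ∈ J`, of
an element related to `x` by `P`. -/
def MatchableAlong {α β : Type*} (P : α → β → Prop) (J : Set α) : Prop :=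
  ∃ f : α → β, Set.InjOn f J ∧ ∀ x ∈ J, P x (f x)

/-- The elements reached from `y` by repeatedly moving from an element `z` of `I` or from `z = y` to
the element `z'` of `B` with `n z' = m z`. -/
inductive AlternatingReach {α β : Type*} (m n : α → β) (I B : Set α) (y : α) : α → Prop
  | start : AlternatingReach m n I B y y
  | step {z z' : α} : AlternatingReach m n I B y z → z ∈ insert y I → z' ∈ B → n z' = m z →
      AlternatingReach m n I B y z'

namespace MatchableAlong

variable {α β : Type*} {P : α → β → Prop}

theorem mono {I J : Set α} (hJ : MatchableAlong P J) (hIJ : I ⊆ J) : MatchableAlong P I := by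
  obtain ⟨f, hf, hP⟩ := hJ
  exact ⟨f, hf.mono hIJ, fun x hx => hP x (hIJ hx)⟩

/-- Let `m` match `I + y` and `n` match `B`. The alternating path that starts at `y` either leaves
`I + y`, and then exchanging `m` for `n` along the path matches `I + x` for its last element
`x ∈ B \ I`; or it stays in `I + y`, and then exchanging `n` for `m` matches `B + y`. The second case
includes infinite paths. -/
theorem exists_insert_of_not_maximal {I B : Set α} (hI : MatchableAlong P I)
    (hImax : ¬ Maximal (MatchableAlong P) I) (hB : Maximal (MatchableAlong P) B) :
    ∃ x ∈ B \ I, MatchableAlong P (insert x I) := by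
  classical
  obtain ⟨y, hyI, hy⟩ : ∃ y, y ∉ I ∧ MatchableAlong P (insert y I) := by
    by_contra hcon
    push Not at hcon
    refine hImax ⟨hI, fun J hJ hIJ x hx => ?_⟩
    by_contra hxI
    exact hcon x hxI (hJ.mono (Set.insert_subset hx hIJ))
  by_cases hyB : y ∈ B
  · exact ⟨y, ⟨hyB, hyI⟩, hy⟩
  obtain ⟨m, hm, hmP⟩ := hy
  obtain ⟨n, hn, hnP⟩ := hB.prop
  set Z := AlternatingReach m n I B y with hZ
  have hZB : ∀ z, Z z → z ≠ y → z ∈ B ∧ ∃ z', Z z' ∧ z' ∈ insert y I ∧ n z = m z' := by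
    intro z hz hzy
    cases hz with
    | start => exact absurd rfl hzy
    | step h1 h2 h3 h4 => exact ⟨h3, _, h1, h2, h4⟩
  by_cases hall : ∀ z, Z z → z ∈ insert y I
  · exfalso
    refine hyB (hB.le_of_ge (y := insert y B) ?_ (Set.subset_insert _ _) (Set.mem_insert _ _))
    refine ⟨fun x => if Z x then m x else n x, ?_, ?_⟩
    · intro x hx x' hx' hxx'
      have key : ∀ x x', x' ∈ insert y B → Z x → ¬ Z x' → m x ≠ n x' := by
        intro x x' hx' h h' he
        have : x' ≠ y := by rintro rfl; exact h' .start
        exact h' (.step h (hall x h) (hx'.resolve_left this) he.symm)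
      by_cases h : Z x <;> by_cases h' : Z x' <;> simp only [h, h', if_true, if_false] at hxx'
      · exact hm (hall x h) (hall x' h') hxx'
      · exact absurd hxx' (key x x' hx' h h')
      · exact absurd hxx'.symm (key x' x hx h' h)
      · have h1 : x ≠ y := by rintro rfl; exact h .start
        have h2 : x' ≠ y := by rintro rfl; exact h' .start
        exact hn (hx.resolve_left h1) (hx'.resolve_left h2) hxx'
    · intro x hx
      by_cases h : Z x
      · simpa only [h, if_true] using hmP x (hall x h)
      · have h1 : x ≠ y := by rintro rfl; exact h .start
        simpa only [h, if_false] using hnP x (hx.resolve_left h1)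
  · push Not at hall
    obtain ⟨x, hxZ, hx⟩ := hall
    have hxy : x ≠ y := fun h => hx (h ▸ Set.mem_insert _ _)
    have hyx : ¬ y ∈ insert x I := fun h => h.elim (fun h => hxy h.symm) hyI
    refine ⟨x, ⟨(hZB x hxZ hxy).1, fun h => hx (Set.mem_insert_of_mem _ h)⟩,
      fun z => if Z z then n z else m z, ?_, ?_⟩
    · intro z hz z' hz' hzz'
      have hne : ∀ z ∈ insert x I, z ≠ y := fun z hz h => hyx (h ▸ hz)
      have hI' : ∀ z ∈ insert x I, ¬ Z z → z ∈ insert y I := by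
        rintro z (rfl | hz) h
        · exact absurd hxZ h
        · exact Set.mem_insert_of_mem _ hz
      have key : ∀ z ∈ insert x I, ∀ z' ∈ insert x I, Z z → ¬ Z z' → n z ≠ m z' := by
        intro z hz z' hz' h h' he
        obtain ⟨-, z₀, h0, h0I, h1⟩ := hZB z h (hne z hz)
        exact h' (hm (hI' z' hz' h') h0I (he.symm.trans h1) ▸ h0)
      by_cases h : Z z <;> by_cases h' : Z z' <;> simp only [h, h', if_true, if_false] at hzz'
      · exact hn (hZB z h (hne z hz)).1 (hZB z' h' (hne z' hz')).1 hzz'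
      · exact absurd hzz' (key z hz z' hz' h h')
      · exact absurd hzz'.symm (key z' hz' z hz h' h)
      · exact hm (hI' z hz h) (hI' z' hz' h') hzz'
    · intro z hz
      have hzy : z ≠ y := fun h => hyx (h ▸ hz)
      by_cases h : Z z
      · simpa only [h, if_true] using hnP z (hZB z h hzy).1
      · rcases hz with rfl | hz
        · exact absurd hxZ h
        · simpa only [h, if_false] using hmP z (Set.mem_insert_of_mem _ hz)

end MatchableAlong

/-! ### Rooted trees and their linkable sets -/

/-- A rooted tree, given by the parent and the depth of each vertex. The parent of the root carries
no information. -/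
structure ParentTree (V : Type*) where
  root : V
  parent : V → V
  depth : V → ℕ
  depth_root : depth root = 0
  depth_eq : ∀ v, v ≠ root → depth v = depth (parent v) + 1

namespace ParentTree

/-- `R.Child v w` means that `w` is a child of `v`. -/
def Child {V : Type*} (R : ParentTree V) (v w : V) : Prop := w ≠ R.root ∧ R.parent w = v

/-- The ways in which a vertex can be linked to the even levels: a vertex on an even level is linked
to itself, and a vertex on an odd level to one of its neighbours. -/
def Link {V : Type*} (R : ParentTree V) (v w : V) : Prop :=
  (Even (R.depth v) → w = v) ∧ (¬ Even (R.depth v) → R.Child v w ∨ R.Child w v)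

/-- The vertices whose subtree is saturated by `Y`: every injective linking of `Y` has to link a
saturated vertex on an odd level to its parent, and to cover a saturated vertex on an even level by
the vertex itself or by one of its children. This is a least fixed point, so only well-founded
subtrees count. -/
inductive Full {V : Type*} (R : ParentTree V) (Y : Set V) : V → Prop
  | odd {a : V} : ¬ Even (R.depth a) → a ∈ Y → (∀ b, R.Child a b → Full R Y b) → Full R Y a
  | even_mem {b : V} : Even (R.depth b) → b ∈ Y → Full R Y b
  | even_child {b a : V} : Even (R.depth b) → R.Child b a → Full R Y a → Full R Y b

/-- The saturated vertices, with an ordinal bound on the rank of the subtree that witnesses it. -/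
inductive FullAt {V : Type u} (R : ParentTree V) (Y : Set V) : Ordinal.{u} → V → Prop
  | odd {a : V} {o : Ordinal.{u}} (rk : V → Ordinal.{u}) : ¬ Even (R.depth a) → a ∈ Y →
      (∀ b, R.Child a b → rk b < o) → (∀ b, R.Child a b → FullAt R Y (rk b) b) → FullAt R Y o a
  | even_mem {b : V} {o : Ordinal.{u}} : Even (R.depth b) → b ∈ Y → FullAt R Y o b
  | even_child {b a : V} {o o' : Ordinal.{u}} : Even (R.depth b) → R.Child b a → o' < o →
      FullAt R Y o' a → FullAt R Y o b

section

variable {V : Type u} {R : ParentTree V}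

theorem Child.depth_eq {v w : V} (h : R.Child v w) : R.depth w = R.depth v + 1 := by
  rw [R.depth_eq w h.1, h.2]

theorem Child.even_iff {v w : V} (h : R.Child v w) : Even (R.depth w) ↔ ¬ Even (R.depth v) := by
  rw [h.depth_eq, Nat.even_add_one]

theorem ne_root_of_odd {a : V} (ha : ¬ Even (R.depth a)) : a ≠ R.root := by
  rintro rfl
  exact ha (by simp [R.depth_root])

theorem child_parent {a : V} (ha : a ≠ R.root) : R.Child (R.parent a) a := ⟨ha, rfl⟩

theorem even_parent {a : V} (ha : ¬ Even (R.depth a)) : Even (R.depth (R.parent a)) := by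
  by_contra h
  exact ha ((child_parent (ne_root_of_odd ha)).even_iff.2 h)

theorem Link.even {v w : V} (h : R.Link v w) : Even (R.depth w) := by
  by_cases hv : Even (R.depth v)
  · rwa [h.1 hv]
  · rcases h.2 hv with h | h
    · exact h.even_iff.2 hv
    · by_contra hw
      exact hv (h.even_iff.2 hw)

namespace Full

variable {X Y : Set V}

theorem mono (hXY : X ⊆ Y) {v : V} (h : R.Full X v) : R.Full Y v := by
  induction h with
  | odd h1 h2 _ ih => exact .odd h1 (hXY h2) ih
  | even_mem h1 h2 => exact .even_mem h1 (hXY h2)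
  | even_child h1 h2 _ ih => exact .even_child h1 h2 ih

theorem mem_of_odd {a : V} (h : R.Full Y a) (ha : ¬ Even (R.depth a)) : a ∈ Y := by
  cases h with
  | odd _ h => exact h
  | even_mem h => exact absurd h ha
  | even_child h => exact absurd h ha

theorem exists_fullAt {v : V} (h : R.Full Y v) : ∃ o, R.FullAt Y o v := by
  classical
  induction h with
  | @odd a h1 h2 _ ih =>
    choose! rk hrk using ih
    exact ⟨⨆ b, Order.succ (rk b), .odd rk h1 h2
      (fun b _ => (Order.lt_succ _).trans_le (Ordinal.le_iSup (fun b => Order.succ (rk b)) b)) hrk⟩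
  | even_mem h1 h2 => exact ⟨0, .even_mem h1 h2⟩
  | even_child h1 h2 _ ih =>
    obtain ⟨o, ho⟩ := ih
    exact ⟨_, .even_child h1 h2 (Order.lt_succ o) ho⟩

end Full

theorem FullAt.full {Y : Set V} {o : Ordinal.{u}} {v : V} (h : R.FullAt Y o v) : R.Full Y v := by
  induction h with
  | odd _ h1 h2 _ _ ih => exact .odd h1 h2 ih
  | even_mem h1 h2 => exact .even_mem h1 h2
  | even_child h1 h2 _ _ ih => exact .even_child h1 h2 ih

/-- Saturation is witnessed by vertices of smaller rank. -/
theorem exists_rank (R : ParentTree V) (Y : Set V) : ∃ rk : V → Ordinal.{u}, ∀ v, R.Full Y v →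
    (¬ Even (R.depth v) → ∀ b, R.Child v b → R.Full Y b ∧ rk b < rk v) ∧
    (Even (R.depth v) → v ∈ Y ∨ ∃ a, R.Child v a ∧ R.Full Y a ∧ rk a < rk v) := by
  refine ⟨fun v => sInf {o | R.FullAt Y o v}, fun v hv => ?_⟩
  have hmem : R.FullAt Y (sInf {o | R.FullAt Y o v}) v := csInf_mem hv.exists_fullAt
  have hle : ∀ {o b}, R.FullAt Y o b → sInf {o | R.FullAt Y o b} ≤ o := fun h => csInf_le' h
  refine ⟨fun ho => ?_, fun he => ?_⟩
  · cases hmem with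
    | odd rk _ _ h1 h2 => exact fun b hb => ⟨(h2 b hb).full, (hle (h2 b hb)).trans_lt (h1 b hb)⟩
    | even_mem h => exact absurd h ho
    | even_child h => exact absurd h ho
  · cases hmem with
    | odd rk h => exact absurd he h
    | even_mem _ h => exact .inl h
    | even_child _ h1 h2 h3 => exact .inr ⟨_, h1, h3.full, (hle h3).trans_lt h2⟩

/-- A linking of `Y` links saturated vertices on odd levels to their parents, and covers saturated
vertices on even levels from below. -/
theorem Full.linking_eq {Y : Set V} {g : V → V} (hg : Set.InjOn g Y) (hP : ∀ v ∈ Y, R.Link v (g v))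
    {v : V} (h : R.Full Y v) :
    (¬ Even (R.depth v) → g v = R.parent v) ∧
      (Even (R.depth v) → ∃ y ∈ Y, g y = v ∧ (y = v ∨ R.Child v y)) := by
  induction h with
  | @odd a h1 h2 _ ih =>
    refine ⟨fun _ => ?_, fun h => absurd h h1⟩
    rcases (hP a h2).2 h1 with h | h
    · exfalso
      obtain ⟨y, hyY, hy, hyc⟩ := (ih _ h).2 (hP a h2).even
      obtain rfl := hg hyY h2 hy
      have h3 := h.depth_eq
      rcases hyc with hyc | hyc
      · rw [← hyc] at h3; omega
      · have := hyc.depth_eq; omega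
    · exact h.2.symm
  | @even_mem b h1 h2 => exact ⟨fun h => absurd h1 h, fun _ => ⟨b, h2, (hP b h2).1 h1, .inl rfl⟩⟩
  | @even_child b a h1 h2 h3 ih =>
    have ha : ¬ Even (R.depth a) := fun h => h2.even_iff.1 h h1
    refine ⟨fun h => absurd h1 h, fun _ => ⟨a, h3.mem_of_odd ha, ?_, .inr h2⟩⟩
    rw [ih.1 ha, h2.2]

end

/-! ### Maximal linkable sets -/

/-- The choices that determine a maximal linkable set between `I` and `X`. For `b` on an even
level, `pick b` is a child of `b` that may be linked to `b`: one that is saturated by `I` if there is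
any, and otherwise one that is saturated by `X` and of least rank. For `a` on an odd level,
`spare a` is a child of `a` to which `a` may be linked: one that is not saturated by `X` if there is any,
and otherwise one that is not saturated by `I`. The ranks `rk` refer to the saturation by `X`. -/
structure Choices {V : Type u} (R : ParentTree V) (X I : Set V) where
  rk : V → Ordinal.{u}
  rk_odd : ∀ v, R.Full X v → ¬ Even (R.depth v) → ∀ b, R.Child v b → R.Full X b ∧ rk b < rk v
  rk_even : ∀ v, R.Full X v → Even (R.depth v) →
    v ∈ X ∨ ∃ a, R.Child v a ∧ R.Full X a ∧ rk a < rk v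
  pick : V → V
  pick_of_lower : ∀ b, (∃ a, R.Child b a ∧ R.Full I a) → R.Child b (pick b) ∧ R.Full I (pick b)
  pick_of_upper : ∀ b, (¬ ∃ a, R.Child b a ∧ R.Full I a) → ∀ a, R.Child b a → R.Full X a →
    R.Child b (pick b) ∧ R.Full X (pick b) ∧ rk (pick b) ≤ rk a
  spare : V → V
  spare_of_upper : ∀ a, (∃ b, R.Child a b ∧ ¬ R.Full X b) →
    R.Child a (spare a) ∧ ¬ R.Full X (spare a)
  spare_of_lower : ∀ a, (∃ b, R.Child a b ∧ ¬ R.Full I b) →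
    R.Child a (spare a) ∧ ¬ R.Full I (spare a)

section

variable {V : Type u} {R : ParentTree V} {X I : Set V}

theorem exists_choices (hIX : I ⊆ X) : Nonempty (R.Choices X I) := by
  classical
  obtain ⟨rk, hrk⟩ := R.exists_rank X
  have hp : ∀ b, ∃ p, ((∃ a, R.Child b a ∧ R.Full I a) → R.Child b p ∧ R.Full I p) ∧
      ((¬ ∃ a, R.Child b a ∧ R.Full I a) → ∀ a, R.Child b a → R.Full X a →
        R.Child b p ∧ R.Full X p ∧ rk p ≤ rk a) := by
    intro b
    by_cases h : ∃ a, R.Child b a ∧ R.Full I a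
    · exact ⟨h.choose, fun _ => h.choose_spec, fun h' => absurd h h'⟩
    · by_cases h' : ∃ a, R.Child b a ∧ R.Full X a
      · obtain ⟨p, hp, hmin⟩ := exists_minimalFor_of_wellFoundedLT
          (fun a => R.Child b a ∧ R.Full X a) rk h'
        exact ⟨p, fun h'' => absurd h'' h, fun _ a ha haX =>
          ⟨hp.1, hp.2, (le_total _ _).elim id (hmin ⟨ha, haX⟩)⟩⟩
      · exact ⟨b, fun h'' => absurd h'' h, fun _ a ha haX => absurd ⟨a, ha, haX⟩ h'⟩
  have hq : ∀ a, ∃ q, ((∃ b, R.Child a b ∧ ¬ R.Full X b) → R.Child a q ∧ ¬ R.Full X q) ∧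
      ((∃ b, R.Child a b ∧ ¬ R.Full I b) → R.Child a q ∧ ¬ R.Full I q) := by
    intro a
    by_cases h : ∃ b, R.Child a b ∧ ¬ R.Full X b
    · exact ⟨h.choose, fun _ => h.choose_spec,
        fun _ => ⟨h.choose_spec.1, fun hf => h.choose_spec.2 (hf.mono hIX)⟩⟩
    · by_cases h' : ∃ b, R.Child a b ∧ ¬ R.Full I b
      · exact ⟨h'.choose, fun h'' => absurd h'' h, fun _ => h'.choose_spec⟩
      · exact ⟨a, fun h'' => absurd h'' h, fun h'' => absurd h'' h'⟩
  choose p hp using hp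
  choose q hq using hq
  exact ⟨⟨rk, fun v h => (hrk v h).1, fun v h => (hrk v h).2, p, fun b => (hp b).1,
    fun b => (hp b).2, q, fun a => (hq a).1, fun a => (hq a).2⟩⟩

namespace Choices

/-- The vertices on even levels that are to cover themselves if they are to be saturated: those in `X`
that no child is forced by `I` to cover. -/
def Own (_S : R.Choices X I) (b : V) : Prop := b ∈ X ∧ ¬ ∃ a, R.Child b a ∧ R.Full I a

/-- The vertices that are to be saturated by the maximal linkable set, determined from the root
downwards. -/
inductive Sat (S : R.Choices X I) : V → Prop
  | root : R.Full X R.root → Sat S R.root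
  | even {b : V} : Even (R.depth b) → b ≠ R.root → R.Full X b →
      (R.parent b ∈ I → b = S.spare (R.parent b) → Sat S (R.parent b)) → Sat S b
  | odd {a : V} : ¬ Even (R.depth a) → Sat S (R.parent a) → ¬ S.Own (R.parent a) →
      a = S.pick (R.parent a) → Sat S a

/-- The maximal linkable set. -/
def base (S : R.Choices X I) : Set V :=
  {v | (Even (R.depth v) → S.Sat v ∧ S.Own v) ∧
    (¬ Even (R.depth v) → S.Sat v ∨ (v ∈ X ∧ (v ∈ I ∨ ∃ b, R.Child v b ∧ ¬ R.Full X b)))}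

variable (S : R.Choices X I)

theorem not_sat_even {b : V} (hb : Even (R.depth b)) (hX : R.Full X b) (h : ¬ S.Sat b) :
    b ≠ R.root ∧ R.parent b ∈ I ∧ b = S.spare (R.parent b) ∧ ¬ S.Sat (R.parent b) := by
  have hr : b ≠ R.root := by
    rintro rfl
    exact h (.root hX)
  by_contra hcon
  refine h (.even hb hr hX fun h1 h2 => ?_)
  by_contra h3
  exact hcon ⟨hr, h1, h2, h3⟩

theorem sat_even {b : V} (hb : Even (R.depth b)) (hr : b ≠ R.root) (h : S.Sat b) :
    R.parent b ∈ I → b = S.spare (R.parent b) → S.Sat (R.parent b) := by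
  cases h with
  | root => exact absurd rfl hr
  | even _ _ _ h => exact h
  | odd h => exact absurd hb h

theorem sat_odd {a : V} (ha : ¬ Even (R.depth a)) (h : S.Sat a) :
    S.Sat (R.parent a) ∧ ¬ S.Own (R.parent a) ∧ a = S.pick (R.parent a) := by
  cases h with
  | root => exact absurd (by simp [R.depth_root]) ha
  | even h => exact absurd h ha
  | odd _ h1 h2 h3 => exact ⟨h1, h2, h3⟩

variable {S}

theorem pick_spec (hIX : I ⊆ X) {b : V} (hX : R.Full X b) (hb : Even (R.depth b))
    (hown : ¬ S.Own b) : R.Child b (S.pick b) ∧ R.Full X (S.pick b) ∧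
      (R.Full I (S.pick b) ∨ S.rk (S.pick b) < S.rk b) := by
  by_cases h : ∃ a, R.Child b a ∧ R.Full I a
  · have h1 := S.pick_of_lower b h
    exact ⟨h1.1, h1.2.mono hIX, .inl h1.2⟩
  · rcases S.rk_even b hX hb with h' | ⟨a, ha, haX, hlt⟩
    · exact absurd ⟨h', h⟩ hown
    · have h1 := S.pick_of_upper b h a ha haX
      exact ⟨h1.1, h1.2.1, .inr (h1.2.2.trans_lt hlt)⟩

/-- Only what `X` saturates is to be saturated. -/
theorem Sat.full (hIX : I ⊆ X) {v : V} (h : S.Sat v) : R.Full X v := by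
  induction h with
  | root h => exact h
  | even _ _ h => exact h
  | odd h1 _ h3 h4 ih =>
    rw [h4]
    exact (pick_spec hIX ih (even_parent h1) h3).2.1

theorem Sat.pick {b : V} (h : S.Sat b) (hIX : I ⊆ X) (hb : Even (R.depth b)) (hown : ¬ S.Own b) :
    S.Sat (S.pick b) := by
  have h1 := (pick_spec hIX (h.full hIX) hb hown).1
  refine .odd (fun h' => h1.even_iff.1 h' hb) ?_ ?_ ?_ <;> rw [h1.2]
  · exact h
  · exact hown

theorem Sat.child (hIX : I ⊆ X) {a b : V} (h : S.Sat a) (ha : ¬ Even (R.depth a))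
    (hb : R.Child a b) : S.Sat b :=
  .even (hb.even_iff.2 ha) hb.1 (S.rk_odd a (h.full hIX) ha b hb).1 fun _ _ => by rwa [hb.2]

theorem spare_spec {a : V} (ha : ¬ Even (R.depth a)) (h : ¬ R.Full I a)
    (hmem : a ∈ I ∨ ∃ b, R.Child a b ∧ ¬ R.Full X b) : R.Child a (S.spare a) := by
  by_cases h1 : ∃ b, R.Child a b ∧ ¬ R.Full X b
  · exact (S.spare_of_upper a h1).1
  · have haI := hmem.resolve_right h1
    refine (S.spare_of_lower a ?_).1
    by_contra h2
    push Not at h2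
    exact h (.odd ha haI h2)

/-- Two saturated children of a vertex would have to be linked to it both. -/
theorem child_unique {g : V → V} (hg : Set.InjOn g I) (hP : ∀ v ∈ I, R.Link v (g v))
    {b a a' : V} (hb : Even (R.depth b)) (ha : R.Child b a) (ha' : R.Child b a') (h : R.Full I a)
    (h' : R.Full I a') : a = a' := by
  have h1 : ¬ Even (R.depth a) := fun h => ha.even_iff.1 h hb
  have h2 : ¬ Even (R.depth a') := fun h => ha'.even_iff.1 h hb
  refine hg (h.mem_of_odd h1) (h'.mem_of_odd h2) ?_
  rw [(h.linking_eq hg hP).1 h1, (h'.linking_eq hg hP).1 h2, ha.2, ha'.2]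

theorem own_of_mem {g : V → V} (hg : Set.InjOn g I) (hP : ∀ v ∈ I, R.Link v (g v)) (hIX : I ⊆ X)
    {b : V} (hb : Even (R.depth b)) (hI : b ∈ I) : S.Own b := by
  refine ⟨hIX hI, ?_⟩
  rintro ⟨a, ha, haI⟩
  have h1 : ¬ Even (R.depth a) := fun h => ha.even_iff.1 h hb
  have h2 : b = a := by
    refine hg hI (haI.mem_of_odd h1) ?_
    rw [(haI.linking_eq hg hP).1 h1, ha.2, (hP b hI).1 hb]
  have := ha.depth_eq
  rw [h2] at this
  omega

/-- What `I` saturates has to be saturated. -/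
theorem sat_of_full {g : V → V} (hg : Set.InjOn g I) (hP : ∀ v ∈ I, R.Link v (g v)) (hIX : I ⊆ X) :
    ∀ (n : ℕ) (v : V), R.depth v = n → R.Full I v → S.Sat v := by
  intro n
  induction n with
  | zero =>
    intro v hv hI
    have : v = R.root := by
      by_contra h
      have := R.depth_eq v h
      omega
    subst this
    exact .root (hI.mono hIX)
  | succ n ih =>
    intro v hv hI
    have hr : v ≠ R.root := by
      rintro rfl
      have := R.depth_root
      omega
    have hd : R.depth (R.parent v) = n := by
      have := R.depth_eq v hr
      omega
    by_cases he : Even (R.depth v)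
    · refine .even he hr (hI.mono hIX) fun h1 h2 => ih _ hd ?_
      have ho : ¬ Even (R.depth (R.parent v)) := (child_parent hr).even_iff.1 he
      refine .odd ho h1 ?_
      by_contra hcon
      push Not at hcon
      exact (S.spare_of_lower _ hcon).2 (h2 ▸ hI)
    · have hpe := even_parent he
      have hex : ∃ a, R.Child (R.parent v) a ∧ R.Full I a := ⟨v, child_parent hr, hI⟩
      have hpick := S.pick_of_lower _ hex
      exact .odd he (ih _ hd (.even_child hpe (child_parent hr) hI)) (fun h => h.2 hex)
        (child_unique hg hP hpe (child_parent hr) hpick.1 hI hpick.2)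

theorem subset_base {g : V → V} (hg : Set.InjOn g I) (hP : ∀ v ∈ I, R.Link v (g v)) (hIX : I ⊆ X) :
    I ⊆ S.base := fun _ hv =>
  ⟨fun he => ⟨sat_of_full hg hP hIX _ _ rfl (.even_mem he hv), own_of_mem hg hP hIX he hv⟩,
    fun _ => .inr ⟨hIX hv, .inl hv⟩⟩

theorem base_subset (hIX : I ⊆ X) : S.base ⊆ X := by
  intro v hv
  by_cases he : Even (R.depth v)
  · exact (hv.1 he).2.1
  · exact (hv.2 he).elim (fun h => (h.full hIX).mem_of_odd he) fun h => h.1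

/-- Saturated vertices on odd levels are linked to their parents, and the others to their spare
children. -/
theorem base_matchable {g : V → V} (hg : Set.InjOn g I) (hP : ∀ v ∈ I, R.Link v (g v))
    (hIX : I ⊆ X) : MatchableAlong R.Link S.base := by
  classical
  let f : V → V := fun v =>
    if Even (R.depth v) then v else if S.Sat v then R.parent v else S.spare v
  have feven : ∀ {v}, Even (R.depth v) → f v = v := fun h => if_pos h
  have fsat : ∀ {v}, ¬ Even (R.depth v) → S.Sat v → f v = R.parent v := fun h h' => by
    simp only [f, h, h', if_true, if_false]
  have fnot : ∀ {v}, ¬ Even (R.depth v) → ¬ S.Sat v → f v = S.spare v := fun h h' => by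
    simp only [f, h, h', if_false]
  have hspare : ∀ {v}, v ∈ S.base → ¬ Even (R.depth v) → ¬ S.Sat v →
      R.Child v (S.spare v) ∧ ¬ S.Sat (S.spare v) := by
    intro v hv ho hs
    have hm := ((hv.2 ho).resolve_left hs).2
    have hc : R.Child v (S.spare v) :=
      spare_spec ho (fun h => hs (sat_of_full hg hP hIX _ _ rfl h)) hm
    refine ⟨hc, fun h => ?_⟩
    by_cases hex : ∃ b, R.Child v b ∧ ¬ R.Full X b
    · exact (S.spare_of_upper v hex).2 (h.full hIX)
    · have h1 := S.sat_even (hc.even_iff.2 ho) hc.1 h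
      rw [hc.2] at h1
      exact hs (h1 (hm.resolve_right hex) rfl)
  refine ⟨f, ?_, ?_⟩
  · have key1 : ∀ {v v'}, v ∈ S.base → v' ∈ S.base → Even (R.depth v) → ¬ Even (R.depth v') →
        f v ≠ f v' := by
      intro v v' hv hv' he ho h
      rw [feven he] at h
      by_cases hs : S.Sat v'
      · rw [fsat ho hs] at h
        exact (S.sat_odd ho hs).2.1 (h ▸ (hv.1 he).2)
      · rw [fnot ho hs] at h
        exact (hspare hv' ho hs).2 (h ▸ (hv.1 he).1)
    have key2 : ∀ {v v'}, v' ∈ S.base → ¬ Even (R.depth v) → ¬ Even (R.depth v') → S.Sat v →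
        ¬ S.Sat v' → f v ≠ f v' := by
      intro v v' hv' ho ho' hs hs' h
      rw [fsat ho hs, fnot ho' hs'] at h
      exact (hspare hv' ho' hs').2 (h ▸ (S.sat_odd ho hs).1)
    intro v hv v' hv' h
    by_cases he : Even (R.depth v) <;> by_cases he' : Even (R.depth v')
    · rwa [feven he, feven he'] at h
    · exact absurd h (key1 hv hv' he he')
    · exact absurd h.symm (key1 hv' hv he' he)
    · by_cases hs : S.Sat v <;> by_cases hs' : S.Sat v'
      · rw [fsat he hs, fsat he' hs'] at h
        rw [(S.sat_odd he hs).2.2, (S.sat_odd he' hs').2.2, h]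
      · exact absurd h (key2 hv' he he' hs hs')
      · exact absurd h.symm (key2 hv he' he hs' hs)
      · rw [fnot he hs, fnot he' hs'] at h
        rw [← (hspare hv he hs).1.2, ← (hspare hv' he' hs').1.2, h]
  · intro v hv
    refine ⟨fun he => feven he, fun ho => ?_⟩
    by_cases hs : S.Sat v
    · rw [fsat ho hs]
      exact .inr (child_parent (ne_root_of_odd ho))
    · rw [fnot ho hs]
      exact .inl (hspare hv ho hs).1

/-- The base saturates the vertices that it is to saturate. The proof is by induction on the rank,
as the chosen children have smaller rank. -/
theorem Sat.full_base {g : V → V} (hg : Set.InjOn g I) (hP : ∀ v ∈ I, R.Link v (g v))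
    (hIX : I ⊆ X) : ∀ (o : Ordinal.{u}) (v : V), S.rk v = o → S.Sat v → R.Full S.base v := by
  intro o
  induction o using WellFoundedLT.induction with
  | ind o ih =>
    intro v hv hs
    have hX := hs.full hIX
    by_cases he : Even (R.depth v)
    · by_cases hown : S.Own v
      · exact .even_mem he ⟨fun _ => ⟨hs, hown⟩, fun h => absurd he h⟩
      · obtain ⟨h1, h2, h3⟩ := pick_spec hIX hX he hown
        refine .even_child he h1 ?_
        rcases h3 with h3 | h3
        · exact h3.mono (subset_base hg hP hIX)
        · exact ih _ (hv ▸ h3) _ rfl (hs.pick hIX he hown)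
    · refine .odd he ⟨fun h => absurd h he, fun _ => .inl hs⟩ fun b hb => ?_
      exact ih _ (hv ▸ (S.rk_odd v hX he b hb).2) b rfl (hs.child hIX he hb)

/-- In a linking `f` of a set `Y` that contains the base, every vertex on an even level that is to
be saturated is covered by itself or by such a child. -/
theorem Sat.covered {g : V → V} (hg : Set.InjOn g I) (hP : ∀ v ∈ I, R.Link v (g v))
    (hIX : I ⊆ X) {Y : Set V} (hY : S.base ⊆ Y) {f : V → V} (hf : Set.InjOn f Y)
    (hfP : ∀ v ∈ Y, R.Link v (f v)) {b : V} (hb : Even (R.depth b)) (h : S.Sat b) :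
    ∃ y ∈ S.base, f y = b ∧ (y = b ∨ (R.Child b y ∧ S.Sat y)) := by
  by_cases hown : S.Own b
  · have hbB : b ∈ S.base := ⟨fun _ => ⟨h, hown⟩, fun h => absurd hb h⟩
    exact ⟨b, hbB, (hfP b (hY hbB)).1 hb, .inl rfl⟩
  · have h1 := (pick_spec hIX (h.full hIX) hb hown).1
    have h2 := h.pick hIX hb hown
    have h3 : ¬ Even (R.depth (S.pick b)) := fun h => h1.even_iff.1 h hb
    have h4 := (Sat.full_base hg hP hIX _ _ rfl h2)
    refine ⟨S.pick b, h4.mem_of_odd h3, ?_, .inr ⟨h1, h2⟩⟩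
    rw [((h4.mono hY).linking_eq hf hfP).1 h3, h1.2]

/-- Let `b` be a vertex on an even level that is saturated by `X`, but not to be saturated by the
base. In a linking of a set that contains the base, only the parent of `b` can be linked to `b`:
otherwise the parent of `b` would have to be linked to its own parent, and so on up to the root. -/
theorem not_covered {g : V → V} (hg : Set.InjOn g I) (hP : ∀ v ∈ I, R.Link v (g v))
    (hIX : I ⊆ X) {Y : Set V} (hY : S.base ⊆ Y) {f : V → V} (hf : Set.InjOn f Y)
    (hfP : ∀ v ∈ Y, R.Link v (f v)) : ∀ (n : ℕ) (b : V), R.depth b = n → Even (R.depth b) →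
      R.Full X b → ¬ S.Sat b → ∀ y ∈ Y, f y = b → y = R.parent b := by
  intro n
  induction n using Nat.strong_induction_on with
  | _ n ih =>
    intro b hn hb hX hs y hy hyb
    by_contra hne
    obtain ⟨hr, h1, h2, h3⟩ := S.not_sat_even hb hX hs
    set a := R.parent b with ha
    have hab : R.Child a b := ⟨hr, rfl⟩
    have hao : ¬ Even (R.depth a) := hab.even_iff.1 hb
    have haY : a ∈ Y := hY (subset_base hg hP hIX h1)
    have hall : ∀ b', R.Child a b' → R.Full X b' := by
      by_contra hcon
      push Not at hcon
      exact (S.spare_of_upper a hcon).2 (h2 ▸ hX)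
    have hfa : R.Child (f a) a := by
      refine ((hfP a haY).2 hao).resolve_left fun hc => ?_
      by_cases hbb : f a = b
      · exact hne (hf hy haY (hyb.trans hbb.symm))
      · have hs' : S.Sat (f a) := by
          refine .even (hc.even_iff.2 hao) hc.1 (hall _ hc) fun _ h => ?_
          rw [hc.2, ← h2] at h
          exact absurd h hbb
        obtain ⟨z, hz, hzf, hzc⟩ := hs'.covered hg hP hIX hY hf hfP (hc.even_iff.2 hao)
        have hza := hf (hY hz) haY hzf
        rcases hzc with hzc | ⟨hzc, -⟩
        · have := hc.depth_eq
          rw [← hzc, hza] at this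
          omega
        · have h5 := hc.depth_eq
          have h6 := hzc.depth_eq
          rw [hza] at h6
          omega
    have hd1 := hab.depth_eq
    have hd2 := hfa.depth_eq
    have he : Even (R.depth (f a)) := (hfP a haY).even
    have hXa : R.Full X (f a) := .even_child he hfa (.odd hao (hIX h1) hall)
    by_cases hs' : S.Sat (f a)
    · obtain ⟨z, hz, hzf, hzc⟩ := hs'.covered hg hP hIX hY hf hfP he
      have hza := hf (hY hz) haY hzf
      rcases hzc with hzc | ⟨-, hzs⟩
      · rw [← hzc, hza] at hd2
        omega
      · exact h3 (hza ▸ hzs)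
    · have h7 := ih _ (by omega) (f a) rfl he hXa hs' a haY rfl
      have hr' : f a ≠ R.root := (S.not_sat_even he hXa hs').1
      have h8 := R.depth_eq _ hr'
      rw [← h7] at h8
      omega

theorem base_maximal {g : V → V} (hg : Set.InjOn g I) (hP : ∀ v ∈ I, R.Link v (g v))
    (hIX : I ⊆ X) : Maximal (fun K => MatchableAlong R.Link K ∧ K ⊆ X) S.base := by
  refine ⟨⟨base_matchable hg hP hIX, base_subset hIX⟩, ?_⟩
  rintro Y ⟨⟨f, hf, hfP⟩, hYX⟩ hY x hx
  by_contra hxB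
  by_cases he : Even (R.depth x)
  · have hfx := (hfP x hx).1 he
    by_cases hs : S.Sat x
    · obtain ⟨z, hz, hzf, -⟩ := hs.covered hg hP hIX hY hf hfP he
      exact hxB (hf (hY hz) hx (hzf.trans hfx.symm) ▸ hz)
    · have hX : R.Full X x := .even_mem he (hYX hx)
      have h1 := not_covered hg hP hIX hY hf hfP _ x rfl he hX hs x hx hfx
      have h2 := R.depth_eq x (S.not_sat_even he hX hs).1
      rw [← h1] at h2
      omega
  · have h1 : ¬ (S.Sat x ∨ (x ∈ X ∧ (x ∈ I ∨ ∃ b, R.Child x b ∧ ¬ R.Full X b))) := fun h =>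
      hxB ⟨fun h' => absurd h' he, fun _ => h⟩
    push Not at h1
    obtain ⟨hs, h2⟩ := h1
    obtain ⟨hxI, hall⟩ := h2 (hYX hx)
    have hYb : ∀ b, R.Child x b → R.Full Y b := fun b hb =>
      (Sat.full_base hg hP hIX _ b rfl (.even (hb.even_iff.2 he) hb.1 (hall b hb)
        fun h => absurd (hb.2 ▸ h) hxI)).mono hY
    have hfx := ((Full.odd he hx hYb).linking_eq hf hfP).1 he
    have hc := child_parent (ne_root_of_odd he)
    have hpe := even_parent he
    have hX : R.Full X (R.parent x) := .even_child hpe hc (.odd he (hYX hx) hall)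
    by_cases hs' : S.Sat (R.parent x)
    · obtain ⟨z, hz, hzf, -⟩ := hs'.covered hg hP hIX hY hf hfP hpe
      exact hxB (hf (hY hz) hx (hzf.trans hfx.symm) ▸ hz)
    · have h3 := not_covered hg hP hIX hY hf hfP _ _ rfl hpe hX hs' x hx hfx
      have h4 := R.depth_eq _ (S.not_sat_even hpe hX hs').1
      have h5 := hc.depth_eq
      rw [← h3] at h4
      omega

end Choices

theorem existsMaximalSubsetProperty (R : ParentTree V) (X : Set V) :
    Matroid.ExistsMaximalSubsetProperty (MatchableAlong R.Link) X := by
  rintro I ⟨g, hg, hP⟩ hIX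
  obtain ⟨S⟩ := exists_choices (R := R) hIX
  exact ⟨S.base, S.subset_base hg hP hIX, S.base_maximal hg hP hIX⟩

/-- The linkable sets of a rooted tree are the independent sets of a matroid. -/
def matroid (R : ParentTree V) : Matroid V :=
  IndepMatroid.matroid
    { E := Set.univ
      Indep := MatchableAlong R.Link
      indep_empty := ⟨id, by simp, by simp⟩
      indep_subset := fun _ _ hJ hIJ => hJ.mono hIJ
      indep_aug := fun _ _ hI hmax hB => hI.exists_insert_of_not_maximal hmax hB
      indep_maximal := fun X _ => R.existsMaximalSubsetProperty X
      subset_ground := fun _ _ => Set.subset_univ _ }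

end

/-! ### A descending path that alternates with respect to a base -/

/-- A path `b 0, a 0, b 1, a 1, …` that descends from the root and alternates with respect to the
linking `f` of the set `U`: the step from `b n` follows the link that covers `b n`, if `b n ∉ U`,
and the step from `a n` avoids the link of `a n`. -/
structure AlternatingRay {V : Type u} (R : ParentTree V) (U : Set V) (f : V → V) where
  b : ℕ → V
  a : ℕ → V
  b_zero : b 0 = R.root
  child_a : ∀ n, R.Child (b n) (a n)
  child_b : ∀ n, R.Child (a n) (b (n + 1))
  b_succ_ne : ∀ n, b (n + 1) ≠ f (a n)
  covered : ∀ n, b n ∉ U → a n ∈ U ∧ f (a n) = b n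

/-- The vertices of the subtree below `a`. -/
inductive Below {V : Type u} (R : ParentTree V) (a : V) : V → Prop
  | refl : Below R a a
  | child {v w : V} : Below R a v → R.Child v w → Below R a w

section

variable {V : Type u} {R : ParentTree V} {U : Set V} {f : V → V}

theorem Child.parent_unique {v v' w : V} (h : R.Child v w) (h' : R.Child v' w) : v = v' :=
  h.2.symm.trans h'.2

theorem Below.depth_le {a v : V} (h : R.Below a v) : R.depth a ≤ R.depth v := by
  induction h with
  | refl => exact le_rfl
  | child _ h ih => have := h.depth_eq; omega

theorem Below.eq_or_parent {a v w : V} (h : R.Below a w) (hc : R.Child v w) :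
    w = a ∨ R.Below a v := by
  cases h with
  | refl => exact .inl rfl
  | child h h' => exact .inr (hc.parent_unique h' ▸ h)

/-- A vertex `b` on an even level outside a maximal linkable set is covered by every linking of this
set, for otherwise `b` could be added. -/
theorem exists_covering (hU : Maximal (MatchableAlong R.Link) U) (hf : Set.InjOn f U)
    (hP : ∀ v ∈ U, R.Link v (f v)) {b : V} (hb : Even (R.depth b)) (hbU : b ∉ U) :
    ∃ a ∈ U, f a = b := by
  classical
  by_contra hcon
  push Not at hcon
  refine hbU (hU.le_of_ge (y := insert b U) ⟨fun v => if v = b then b else f v, ?_, ?_⟩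
    (Set.subset_insert _ _) (Set.mem_insert _ _))
  · rintro v (rfl | hv) v' (rfl | hv') h
    · rfl
    · have : v' ≠ v := fun h => hbU (h ▸ hv')
      simp only [if_true, this, if_false] at h
      exact absurd h.symm (hcon v' hv')
    · have : v ≠ v' := fun h => hbU (h ▸ hv)
      simp only [if_true, this, if_false] at h
      exact absurd h (hcon v hv)
    · have h1 : v ≠ b := fun h => hbU (h ▸ hv)
      have h2 : v' ≠ b := fun h => hbU (h ▸ hv')
      simp only [h1, h2, if_false] at h
      exact hf hv hv' h
  · rintro v (rfl | hv)
    · simp only [if_true]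
      exact ⟨fun _ => rfl, fun h => absurd hb h⟩
    · have h1 : v ≠ b := fun h => hbU (h ▸ hv)
      simpa only [h1, if_false] using hP v hv

theorem exists_alternatingRay (hU : Maximal (MatchableAlong R.Link) U) (hf : Set.InjOn f U)
    (hP : ∀ v ∈ U, R.Link v (f v)) (hch : ∀ v x, ∃ w, R.Child v w ∧ w ≠ x) :
    Nonempty (R.AlternatingRay U f) := by
  classical
  choose ch hch using hch
  have hna : ∀ b, ∃ a, (b ∈ U → R.Child b a) ∧
      (Even (R.depth b) → b ∉ U → a ∈ U ∧ f a = b) := by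
    intro b
    by_cases hb : b ∈ U
    · exact ⟨ch b b, fun _ => (hch b b).1, fun _ h => absurd hb h⟩
    · by_cases he : Even (R.depth b)
      · obtain ⟨a, ha⟩ := exists_covering hU hf hP he hb
        exact ⟨a, fun h => absurd h hb, fun _ _ => ha⟩
      · exact ⟨b, fun h => absurd h hb, fun h => absurd h he⟩
  choose na hna using hna
  let b : ℕ → V := fun n => Nat.rec R.root (fun _ x => ch (na x) (f (na x))) n
  have hb0 : b 0 = R.root := rfl
  have hbs : ∀ n, b (n + 1) = ch (na (b n)) (f (na (b n))) := fun n => rfl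
  have hcb : ∀ n, R.Child (na (b n)) (b (n + 1)) := fun n => by rw [hbs]; exact (hch _ _).1
  have hne : ∀ n, b (n + 1) ≠ f (na (b n)) := fun n => by rw [hbs]; exact (hch _ _).2
  -- The vertex covering `b n` cannot be its parent, since the path avoids the links of the `a n`.
  have hmain : ∀ n, Even (R.depth (b n)) ∧ R.Child (b n) (na (b n)) := by
    have hstep : ∀ n, Even (R.depth (b n)) → (∀ a, f a = b n → ¬ R.Child a (b n)) →
        R.Child (b n) (na (b n)) := by
      intro n he hpar
      by_cases hU' : b n ∈ U
      · exact (hna (b n)).1 hU'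
      · obtain ⟨h1, h2⟩ := (hna (b n)).2 he hU'
        have hl := hP _ h1
        rw [h2] at hl
        have ho : ¬ Even (R.depth (na (b n))) := fun h => hU' (by rw [hl.1 h]; exact h1)
        exact (hl.2 ho).resolve_left (hpar _ h2)
    intro n
    induction n with
    | zero =>
      have he : Even (R.depth (b 0)) := by rw [hb0, R.depth_root]; exact .zero
      exact ⟨he, hstep 0 he fun a _ h => h.1 hb0⟩
    | succ n ih =>
      have he : Even (R.depth (b (n + 1))) :=
        (hcb n).even_iff.2 fun h => ih.2.even_iff.1 h ih.1
      refine ⟨he, hstep (n + 1) he fun a ha h => hne n ?_⟩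
      rw [← h.parent_unique (hcb n), ha]
  exact ⟨⟨b, fun n => na (b n), hb0, fun n => (hmain n).2, hcb, hne,
    fun n h => (hna (b n)).2 (hmain n).1 h⟩⟩

namespace AlternatingRay

open Classical in
/-- The element outside `U` that can replace `b n ∈ U`: this is `a n`, unless `a n` belongs to `U`,
in which case it is the vertex to which `a n` is linked. -/
noncomputable def entering (r : R.AlternatingRay U f) (n : ℕ) : V :=
  if r.a n ∈ U then f (r.a n) else r.a n

variable (r : R.AlternatingRay U f)

theorem depth_b (n : ℕ) : R.depth (r.b n) = 2 * n := by
  induction n with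
  | zero => rw [r.b_zero, R.depth_root]
  | succ n ih =>
    have h1 := (r.child_a n).depth_eq
    have h2 := (r.child_b n).depth_eq
    omega

theorem depth_a (n : ℕ) : R.depth (r.a n) = 2 * n + 1 := by
  rw [(r.child_a n).depth_eq, r.depth_b]

theorem even_b (n : ℕ) : Even (R.depth (r.b n)) := by rw [depth_b]; exact even_two_mul n

theorem odd_a (n : ℕ) : ¬ Even (R.depth (r.a n)) := fun h =>
  (r.child_a n).even_iff.1 h (r.even_b n)

theorem b_injective {m n : ℕ} (h : r.b m = r.b n) : m = n := by
  have := r.depth_b m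
  rw [h, r.depth_b] at this
  omega

theorem a_injective {m n : ℕ} (h : r.a m = r.a n) : m = n := by
  have := r.depth_a m
  rw [h, r.depth_a] at this
  omega

theorem entering_of_mem {n : ℕ} (h : r.a n ∈ U) : r.entering n = f (r.a n) := if_pos h

theorem entering_of_notMem {n : ℕ} (h : r.a n ∉ U) : r.entering n = r.a n := if_neg h

variable {r}

theorem link_notMem (hf : Set.InjOn f U) (hP : ∀ v ∈ U, R.Link v (f v)) {v : V} (hv : v ∈ U)
    (ho : ¬ Even (R.depth v)) : f v ∉ U := by
  intro h
  have h1 : Even (R.depth (f v)) := (hP v hv).even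
  have h2 := hf h hv ((hP _ h).1 h1)
  exact ho (h2 ▸ h1)

theorem entering_notMem (hf : Set.InjOn f U) (hP : ∀ v ∈ U, R.Link v (f v)) (n : ℕ) :
    r.entering n ∉ U := by
  by_cases h : r.a n ∈ U
  · rw [r.entering_of_mem h]
    exact link_notMem hf hP h (r.odd_a n)
  · rwa [r.entering_of_notMem h]

/-- Link `a n` to `b n`. -/
theorem exchange_matchable (hf : Set.InjOn f U) (hP : ∀ v ∈ U, R.Link v (f v)) {n : ℕ}
    (hn : r.b n ∈ U) : MatchableAlong R.Link (insert (r.entering n) (U \ {r.b n})) := by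
  classical
  have hfb : f (r.b n) = r.b n := (hP _ hn).1 (r.even_b n)
  have hkU := entering_notMem (r := r) hf hP n
  have hka : r.entering n ≠ r.a n → r.a n ∈ U ∧ r.entering n = f (r.a n) := by
    intro h
    by_cases h' : r.a n ∈ U
    · exact ⟨h', r.entering_of_mem h'⟩
    · exact absurd (r.entering_of_notMem h') h
  let g : V → V := fun v => if v = r.a n then r.b n else if v = r.entering n then v else f v
  have g1 : g (r.a n) = r.b n := if_pos rfl
  have g2 : r.entering n ≠ r.a n → g (r.entering n) = r.entering n := fun h => by
    simp only [g, h, if_true, if_false]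
  have g3 : ∀ {v}, v ∈ U → v ≠ r.a n → g v = f v := fun hv h => by
    have : _ ≠ r.entering n := fun h => hkU (h ▸ hv)
    simp only [g, h, this, if_false]
  have hmem : ∀ v ∈ insert (r.entering n) (U \ {r.b n}), v = r.a n ∨
      (v = r.entering n ∧ r.entering n ≠ r.a n) ∨ (v ∈ U ∧ v ≠ r.b n ∧ v ≠ r.a n) := by
    rintro v (rfl | ⟨hv, hvb⟩)
    · exact (em _).imp_right fun h => .inl ⟨rfl, h⟩
    · exact (em _).imp_right fun h => .inr ⟨hv, hvb, h⟩
  refine ⟨g, ?_, ?_⟩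
  · have hbk : r.b n ≠ r.entering n := fun h => hkU (h ▸ hn)
    have hbf : ∀ v, v ∈ U → v ≠ r.b n → r.b n ≠ f v := fun v hv h h' =>
      h (hf hv hn (h'.symm.trans hfb.symm))
    have hkf : ∀ v, v ∈ U → v ≠ r.a n → r.entering n ≠ r.a n → r.entering n ≠ f v :=
      fun v hv h h1 h' => h (hf hv (hka h1).1 (h'.symm.trans (hka h1).2))
    intro v hv v' hv' h
    rcases hmem v hv with rfl | ⟨rfl, h1⟩ | ⟨h1, h2, h3⟩ <;>
      rcases hmem v' hv' with rfl | ⟨rfl, h1'⟩ | ⟨h1', h2', h3'⟩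
    · rfl
    · rw [g1, g2 h1'] at h; exact absurd h hbk
    · rw [g1, g3 h1' h3'] at h; exact absurd h (hbf _ h1' h2')
    · rw [g1, g2 h1] at h; exact absurd h.symm hbk
    · rfl
    · rw [g2 h1, g3 h1' h3'] at h; exact absurd h (hkf _ h1' h3' h1)
    · rw [g1, g3 h1 h3] at h; exact absurd h.symm (hbf _ h1 h2)
    · rw [g2 h1', g3 h1 h3] at h; exact absurd h.symm (hkf _ h1 h3 h1')
    · rw [g3 h1 h3, g3 h1' h3'] at h; exact hf h1 h1' h
  · intro v hv
    rcases hmem v hv with rfl | ⟨rfl, h1⟩ | ⟨h1, h2, h3⟩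
    · rw [g1]
      exact ⟨fun h => absurd h (r.odd_a n), fun _ => .inr (r.child_a n)⟩
    · rw [g2 h1]
      refine ⟨fun _ => rfl, fun h => absurd ?_ h⟩
      rw [(hka h1).2]
      exact (hP _ (hka h1).1).even
    · rw [g3 h1 h3]
      exact hP v h1

/-- The fundamental circuit of `entering i` lies below `b i`. So if `entering i` could replace `b j`
with `j < i`, then the new linking below `a i` and the old one elsewhere would link
`U + entering i`. -/
theorem not_exchange_matchable (hU : Maximal (MatchableAlong R.Link) U) (hf : Set.InjOn f U)
    (hP : ∀ v ∈ U, R.Link v (f v)) {i j : ℕ} (hi : r.b i ∈ U) (hji : j < i) :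
    ¬ MatchableAlong R.Link (insert (r.entering i) (U \ {r.b j})) := by
  classical
  rintro ⟨g, hg, hgP⟩
  set a := r.a i with ha
  set k := r.entering i with hk
  have hkU : k ∉ U := entering_notMem hf hP i
  have hfb : f (r.b i) = r.b i := (hP _ hi).1 (r.even_b i)
  have hbU : r.b i ∈ insert k (U \ {r.b j}) :=
    .inr ⟨hi, fun h => hji.ne' (r.b_injective h)⟩
  have hgb : g (r.b i) = r.b i := (hgP _ hbU).1 (r.even_b i)
  have hab : a ≠ r.b i := fun h => r.odd_a i (by rw [← ha, h]; exact r.even_b i)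
  have hbel : ∀ m ≤ i, ¬ R.Below a (r.b m) := by
    intro m hm h
    have h1 := h.depth_le
    have h2 : R.depth a = 2 * i + 1 := r.depth_a i
    rw [r.depth_b] at h1
    omega
  have hkb : R.Below a k := by
    by_cases h : r.a i ∈ U
    · rw [hk, r.entering_of_mem h]
      refine .child .refl (((hP _ h).2 (r.odd_a i)).resolve_right fun hc => hab ?_)
      exact hf h hi ((hc.parent_unique (r.child_a i)).trans hfb.symm)
    · rw [hk, r.entering_of_notMem h]
      exact .refl
  have hin : ∀ v ∈ insert k U, R.Below a v → v ∈ insert k (U \ {r.b j}) := by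
    rintro v (rfl | hv) h
    · exact .inl rfl
    · exact .inr ⟨hv, fun h' => hbel j hji.le (h' ▸ h)⟩
  have hout : ∀ v ∈ insert k U, ¬ R.Below a v → v ∈ U := by
    rintro v (rfl | hv) h
    · exact absurd hkb h
    · exact hv
  have key : ∀ v ∈ insert k U, ∀ v' ∈ insert k U, R.Below a v → ¬ R.Below a v' → g v ≠ f v' := by
    intro v hv v' hv' h h' he
    have hl := hgP v (hin v hv h)
    have hl' := hP v' (hout v' hv' h')
    rw [← he] at hl'
    have hnb : ¬ R.Below a (g v) := by
      intro hb
      by_cases hev : Even (R.depth v')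
      · exact h' (hl'.1 hev ▸ hb)
      · rcases hl'.2 hev with hc | hc
        · refine (hb.eq_or_parent hc).elim (fun h => r.odd_a i ?_) h'
          rw [← ha, ← h]
          exact hl'.even
        · exact h' (.child hb hc)
    have hev : ¬ Even (R.depth v) := fun hev => hnb (by rw [hl.1 hev]; exact h)
    rcases hl.2 hev with hc | hc
    · exact hnb (.child h hc)
    · obtain rfl := (h.eq_or_parent hc).resolve_right hnb
      exact hab (hg (hin _ hv h) hbU ((hc.parent_unique (r.child_a i)).trans hgb.symm))
  refine hkU (hU.le_of_ge (y := insert k U) ⟨fun v => if R.Below a v then g v else f v, ?_, ?_⟩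
    (Set.subset_insert _ _) (Set.mem_insert _ _))
  · intro v hv v' hv' he
    by_cases h : R.Below a v <;> by_cases h' : R.Below a v' <;>
      simp only [h, h', if_true, if_false] at he
    · exact hg (hin v hv h) (hin v' hv' h') he
    · exact absurd he (key v hv v' hv' h h')
    · exact absurd he.symm (key v' hv' v hv h' h)
    · exact hf (hout v hv h) (hout v' hv' h') he
  · intro v hv
    by_cases h : R.Below a v <;> simp only [h, if_true, if_false]
    · exact hgP v (hin v hv h)
    · exact hP v (hout v hv h)

variable (r) in
/-- The result of replacing every vertex `b n` of the ray in `U` by `entering n`. -/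
def exchange : Set V := (U \ r.b '' {n | r.b n ∈ U}) ∪ r.entering '' {n | r.b n ∈ U}

theorem eq_a_of_link_eq_b (hf : Set.InjOn f U) {v : V} (hv : v ∈ U) {n : ℕ} (hn : r.b n ∉ U)
    (h : f v = r.b n) : v = r.a n :=
  hf hv (r.covered n hn).1 (h.trans (r.covered n hn).2.symm)

theorem root_notMem_exchange (hf : Set.InjOn f U) (hP : ∀ v ∈ U, R.Link v (f v)) :
    R.root ∉ r.exchange := by
  rw [← r.b_zero]
  rintro (⟨h1, h2⟩ | ⟨n, hn, h⟩)
  · exact h2 ⟨0, h1, rfl⟩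
  · have h0 : r.b 0 ∉ U := h ▸ entering_notMem hf hP n
    by_cases ha : r.a n ∈ U
    · rw [r.entering_of_mem ha] at h
      have := r.a_injective (eq_a_of_link_eq_b hf ha h0 h)
      subst this
      exact h0 hn
    · rw [r.entering_of_notMem ha] at h
      exact r.odd_a n (h ▸ r.even_b 0)

/-- Exchanging along the whole ray frees the root: link every `a n` to `b (n + 1)`. -/
theorem insert_root_exchange_matchable (hf : Set.InjOn f U) (hP : ∀ v ∈ U, R.Link v (f v)) :
    MatchableAlong R.Link (insert R.root r.exchange) := by
  classical
  have hnext : ∀ v, ∃ w, ∀ n, v = r.a n → w = r.b (n + 1) := by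
    intro v
    by_cases h : ∃ n, v = r.a n
    · obtain ⟨n, rfl⟩ := h
      exact ⟨r.b (n + 1), fun m hm => by rw [r.a_injective hm]⟩
    · exact ⟨v, fun n hn => absurd ⟨n, hn⟩ h⟩
  choose next hnext using hnext
  let g : V → V := fun v => if v ∈ Set.range r.a then next v else if v ∈ U then f v else v
  have g1 : ∀ n, g (r.a n) = r.b (n + 1) := fun n => by
    simp only [g, Set.mem_range_self, if_true]
    exact hnext _ n rfl
  have g2 : ∀ {v}, v ∉ Set.range r.a → v ∈ U → g v = f v := fun h h' => by
    simp only [g, h, h', if_true, if_false]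
  have g3 : ∀ {v}, v ∉ Set.range r.a → v ∉ U → g v = v := fun h h' => by
    simp only [g, h, h', if_false]
  -- The last case consists of the root and of the vertices `entering n = f (a n)`.
  have hmem : ∀ v ∈ insert R.root r.exchange, v ∈ Set.range r.a ∨
      (v ∉ Set.range r.a ∧ v ∈ U ∧ ∀ n, v ≠ r.b (n + 1)) ∨
      (v ∉ Set.range r.a ∧ v ∉ U ∧
        ((v = r.b 0) ∨ ∃ n, r.b n ∈ U ∧ r.a n ∈ U ∧ v = f (r.a n))) := by
    intro v hv
    by_cases ha : v ∈ Set.range r.a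
    · exact .inl ha
    · refine .inr ?_
      rcases hv with rfl | ⟨h1, h2⟩ | ⟨n, hn, rfl⟩
      · rw [← r.b_zero] at ha ⊢
        by_cases hU : r.b 0 ∈ U
        · exact .inl ⟨ha, hU, fun n h => by simpa using r.b_injective h⟩
        · exact .inr ⟨ha, hU, .inl rfl⟩
      · exact .inl ⟨ha, h1, fun n h => h2 ⟨n + 1, show r.b (n + 1) ∈ U from h ▸ h1, h.symm⟩⟩
      · refine .inr ⟨ha, entering_notMem hf hP n, .inr ⟨n, hn, ?_⟩⟩
        by_cases h : r.a n ∈ U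
        · exact ⟨h, r.entering_of_mem h⟩
        · exact absurd ⟨n, (r.entering_of_notMem h).symm⟩ ha
  have k12 : ∀ n v, v ∉ Set.range r.a → v ∈ U → (∀ n, v ≠ r.b (n + 1)) → r.b (n + 1) ≠ f v := by
    intro n v h1 h2 h3 h
    by_cases hb : r.b (n + 1) ∈ U
    · refine h3 n (hf h2 hb ?_)
      rw [← h, (hP _ hb).1 (r.even_b _)]
    · exact h1 ⟨n + 1, (eq_a_of_link_eq_b hf h2 hb h.symm).symm⟩
  have k13 : ∀ n v, v ∉ U → ((v = r.b 0) ∨ ∃ n, r.b n ∈ U ∧ r.a n ∈ U ∧ v = f (r.a n)) →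
      r.b (n + 1) ≠ v := by
    rintro n v hv (rfl | ⟨m, hm, ha, rfl⟩) h
    · simpa using r.b_injective h
    · rw [← h] at hv
      have := r.a_injective (eq_a_of_link_eq_b hf ha hv h.symm)
      subst this
      exact hv hm
  have k23 : ∀ v v', v ∉ Set.range r.a → v ∈ U → v' ∉ U →
      ((v' = r.b 0) ∨ ∃ n, r.b n ∈ U ∧ r.a n ∈ U ∧ v' = f (r.a n)) → f v ≠ v' := by
    rintro v v' h1 h2 h3 (rfl | ⟨m, hm, ha, rfl⟩) h
    · exact h1 ⟨0, (eq_a_of_link_eq_b hf h2 h3 h).symm⟩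
    · exact h1 ⟨m, (hf h2 ha h).symm⟩
  refine ⟨g, ?_, ?_⟩
  · intro v hv v' hv' h
    rcases hmem v hv with ⟨n, rfl⟩ | ⟨h1, h2, h3⟩ | ⟨h1, h2, h3⟩ <;>
      rcases hmem v' hv' with ⟨n', rfl⟩ | ⟨h1', h2', h3'⟩ | ⟨h1', h2', h3'⟩
    · rw [g1, g1] at h
      have := r.b_injective h
      rw [Nat.succ_injective this]
    · rw [g1, g2 h1' h2'] at h; exact absurd h (k12 n v' h1' h2' h3')
    · rw [g1, g3 h1' h2'] at h; exact absurd h (k13 n v' h2' h3')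
    · rw [g1, g2 h1 h2] at h; exact absurd h.symm (k12 n' v h1 h2 h3)
    · rw [g2 h1 h2, g2 h1' h2'] at h; exact hf h2 h2' h
    · rw [g2 h1 h2, g3 h1' h2'] at h; exact absurd h (k23 v v' h1 h2 h2' h3')
    · rw [g1, g3 h1 h2] at h; exact absurd h.symm (k13 n' v h2 h3)
    · rw [g3 h1 h2, g2 h1' h2'] at h; exact absurd h.symm (k23 v' v h1' h2' h2 h3)
    · rwa [g3 h1 h2, g3 h1' h2'] at h
  · intro v hv
    rcases hmem v hv with ⟨n, rfl⟩ | ⟨h1, h2, h3⟩ | ⟨h1, h2, h3⟩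
    · rw [g1]
      exact ⟨fun h => absurd h (r.odd_a n), fun _ => .inl (r.child_b n)⟩
    · rw [g2 h1 h2]
      exact hP v h2
    · rw [g3 h1 h2]
      refine ⟨fun _ => rfl, fun h => absurd ?_ h⟩
      rcases h3 with rfl | ⟨n, -, ha, rfl⟩
      · exact r.even_b 0
      · exact (hP _ ha).even

end AlternatingRay

end

end ParentTree

/-! ### Exchanges in path-transversal systems -/

/-- A shortest walk along a relation visits no element twice. -/
theorem Relation.ReflTransGen.exists_injOn {α : Type*} {r : α → α → Prop} {x y : α}
    (h : Relation.ReflTransGen r x y) : ∃ (l : ℕ) (γ : ℕ → α), γ 0 = x ∧ γ l = y ∧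
      (∀ i < l, r (γ i) (γ (i + 1))) ∧ Set.InjOn γ (Set.Iic l) := by
  classical
  have hex : ∃ (l : ℕ) (γ : ℕ → α), γ 0 = x ∧ γ l = y ∧ ∀ i < l, r (γ i) (γ (i + 1)) := by
    induction h using Relation.ReflTransGen.head_induction_on with
    | refl => exact ⟨0, fun _ => y, rfl, rfl, by simp⟩
    | @head a c hac _ ih =>
      obtain ⟨l, γ, h0, hl, hs⟩ := ih
      refine ⟨l + 1, fun n => Nat.casesOn n a γ, rfl, hl, fun i hi => ?_⟩
      cases i with
      | zero => simpa [h0] using hac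
      | succ i => exact hs i (by omega)
  obtain ⟨γ, h0, hl, hs⟩ := Nat.find_spec hex
  set l := Nat.find hex
  have hlt : ∀ i j, i < j → j ≤ l → γ i ≠ γ j := by
    intro i j hij hj he
    refine Nat.find_min hex (m := l - (j - i)) (by omega)
      ⟨fun t => if t ≤ i then γ t else γ (t + (j - i)), by simpa using h0, ?_, ?_⟩
    · by_cases h : l - (j - i) ≤ i
      · have h1 : l - (j - i) = i := by omega
        have h2 : j = l := by omega
        simp only [h1, le_refl, if_true]
        rw [he, h2, hl]
      · have h1 : l - (j - i) + (j - i) = l := by omega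
        simp only [h, if_false, h1, hl]
    · intro t ht
      rcases lt_trichotomy t i with h | h | h
      · have h1 : t + 1 ≤ i := h
        simp only [h.le, h1, if_true]
        exact hs t (by omega)
      · subst h
        have h1 : ¬ t + 1 ≤ t := by omega
        simp only [le_refl, h1, if_true, if_false]
        rw [he, show t + 1 + (j - t) = j + 1 by omega]
        exact hs j (by omega)
      · have h1 : ¬ t ≤ i := by omega
        have h2 : ¬ t + 1 ≤ i := by omega
        simp only [h1, h2, if_false]
        rw [show t + 1 + (j - i) = t + (j - i) + 1 by omega]
        exact hs _ (by omega)
  refine ⟨l, γ, h0, hl, hs, fun i hi j hj he => ?_⟩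
  rcases lt_trichotomy i j with h | h | h
  · exact absurd he (hlt i j h hj)
  · exact h
  · exact absurd he.symm (hlt j i h hi)

/-- A set of vertices that contains with each vertex also its neighbours contains the components of
its members. -/
theorem SimpleGraph.supp_connectedComponentMk_subset {V : Type*} {H : SimpleGraph V} {S : Set V}
    (hS : ∀ x ∈ S, ∀ y, H.Adj x y → y ∈ S) {x : V} (hx : x ∈ S) :
    (H.connectedComponentMk x).supp ⊆ S := by
  intro y hy
  have hr : H.Reachable x y := (SimpleGraph.ConnectedComponent.exact hy).symm
  obtain ⟨p⟩ := hr
  induction p with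
  | nil => exact hx
  | cons h _ ih => exact ih (hS _ hx _ h) ((SimpleGraph.ConnectedComponent.sound ⟨‹_›⟩).symm)

theorem bipartiteGraph_adj {V W : Type*} {E : Set (V × W)} {v : V} {w : W} (h : (v, w) ∈ E) :
    (bipartiteGraph E).Adj (Sum.inl v) (Sum.inr w) := by
  simp only [bipartiteGraph, SimpleGraph.fromRel_adj]
  exact ⟨by simp, .inl ⟨(v, w), h, rfl, rfl⟩⟩

/-- If each vertex lies in a finite set that no edge leaves, then all components are finite. -/
theorem bipartiteGraph_supp_finite {V W : Type*} {E : Set (V × W)}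
    (h : ∀ x : V ⊕ W, ∃ S : Set (V ⊕ W), S.Finite ∧ x ∈ S ∧
      ∀ v w, (v, w) ∈ E → (Sum.inl v ∈ S ↔ Sum.inr w ∈ S))
    (c : (bipartiteGraph E).ConnectedComponent) : c.supp.Finite := by
  induction c using SimpleGraph.ConnectedComponent.ind with
  | h x =>
    obtain ⟨S, hfin, hx, hS⟩ := h x
    refine hfin.subset (SimpleGraph.supp_connectedComponentMk_subset ?_ hx)
    intro y hy z hyz
    simp only [bipartiteGraph, SimpleGraph.fromRel_adj] at hyz
    obtain ⟨-, ⟨e, he, rfl, rfl⟩ | ⟨e, he, rfl, rfl⟩⟩ := hyz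
    · exact (hS _ _ he).1 hy
    · exact (hS _ _ he).2 hy

namespace Bimaze

variable {V : Type v} {W : Type w} (G : Bimaze V W)

/-- The left vertices covered by the identity matching. -/
def idSet : Set V := Prod.fst '' G.idMatching

/-- `G.Step x y` means that `x` has an edge to the right vertex to which the identity matching
matches `y`. -/
def Step (x y : V) : Prop := ∃ w, (x, w) ∈ G.edges ∧ (y, w) ∈ G.idMatching

variable {G}

theorem Step.mem {x y : V} (h : G.Step x y) : y ∈ G.idSet := by
  obtain ⟨w, -, h⟩ := h
  exact ⟨(y, w), h, rfl⟩

theorem idMatching_left_unique {v v' : V} {w : W} (h : (v, w) ∈ G.idMatching)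
    (h' : (v', w) ∈ G.idMatching) : v = v' :=
  congrArg Prod.fst (G.idMatching_noShared _ h _ h' (.inr rfl))

theorem idMatching_right_unique {v : V} {w w' : W} (h : (v, w) ∈ G.idMatching)
    (h' : (v, w') ∈ G.idMatching) : w = w' :=
  congrArg Prod.snd (G.idMatching_noShared _ h _ h' (.inl rfl))

theorem exists_idMatching (G : Bimaze V W) (w : W) : ∃ v, (v, w) ∈ G.idMatching := by
  have h : w ∈ Prod.snd '' G.idMatching := by rw [G.idMatching_onto]; trivial
  obtain ⟨⟨v, w'⟩, h, rfl⟩ := h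
  exact ⟨v, h⟩

/-- The alternating path that starts at `u` with an edge of `m` stays in a component of `m₀ ∪ m`,
which is finite, and so it ends. -/
theorem IdMatchable.exists_reachable {I : Set V} (hI : G.IdMatchable I) {u : V} (hu : u ∈ I)
    (huK : u ∉ G.idSet) : ∃ k ∈ G.idSet \ I, Relation.ReflTransGen G.Step u k := by
  classical
  obtain ⟨m, ⟨⟨hmE, hm⟩, hfin⟩, rfl⟩ := hI
  by_contra hcon
  push Not at hcon
  have hmem : ∀ x, Relation.ReflTransGen G.Step u x → x ∈ Prod.fst '' m := by
    intro x hx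
    by_contra hxI
    refine hcon x ⟨?_, hxI⟩ hx
    rcases hx.cases_tail with rfl | ⟨_, -, h⟩
    · exact absurd hu hxI
    · exact h.mem
  have hφ : ∀ x, ∃ y, x ∈ Prod.fst '' m → ∃ w, (x, w) ∈ m ∧ (y, w) ∈ G.idMatching := by
    intro x
    by_cases hx : x ∈ Prod.fst '' m
    · obtain ⟨⟨x, w⟩, h, rfl⟩ := hx
      obtain ⟨y, hy⟩ := G.exists_idMatching w
      exact ⟨y, fun _ => ⟨w, h, hy⟩⟩
    · exact ⟨x, fun h => absurd h hx⟩
  choose φ hφ using hφ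
  set H := bipartiteGraph (G.idMatching ∪ m)
  let S : Set V := {x | Relation.ReflTransGen G.Step u x ∧
    Sum.inl x ∈ (H.connectedComponentMk (Sum.inl u)).supp}
  have hS : S.Finite :=
    ((hfin (H.connectedComponentMk (Sum.inl u))).preimage Sum.inl_injective.injOn).subset
      fun x hx => hx.2
  have hmaps : Set.MapsTo φ S S := by
    intro x hx
    obtain ⟨w, h1, h2⟩ := hφ x (hmem x hx.1)
    refine ⟨hx.1.tail ⟨w, hmE h1, h2⟩, ?_⟩
    have h3 : H.Adj (Sum.inl x) (Sum.inr w) := bipartiteGraph_adj (.inr h1)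
    have h4 : H.Adj (Sum.inl (φ x)) (Sum.inr w) := bipartiteGraph_adj (.inl h2)
    have h5 : H.Reachable (Sum.inl (φ x)) (Sum.inl x) := h4.reachable.trans h3.symm.reachable
    exact (SimpleGraph.ConnectedComponent.sound h5).trans hx.2
  have hinj : Set.InjOn φ S := by
    intro x hx y hy hxy
    obtain ⟨w, h1, h2⟩ := hφ x (hmem x hx.1)
    obtain ⟨w', h1', h2'⟩ := hφ y (hmem y hy.1)
    rw [← hxy] at h2'
    obtain rfl := idMatching_right_unique h2 h2'
    exact congrArg Prod.fst (hm _ h1 _ h1' (.inr rfl))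
  have := hS.to_subtype
  obtain ⟨⟨x, hx⟩, hxu⟩ := Finite.surjective_of_injective (hmaps.restrict_inj.2 hinj)
    ⟨u, Relation.ReflTransGen.refl, rfl⟩
  obtain ⟨w, -, h2⟩ := hφ x (hmem x hx.1)
  have h3 : φ x = u := congrArg Subtype.val hxu
  exact huK ⟨_, h2, h3⟩

/-- The identity matching can be changed simultaneously along disjoint finite alternating paths. -/
theorem idMatchable_of_walks {ι : Type*} (l : ι → ℕ) (γ : ι → ℕ → V)
    (hstep : ∀ n, ∀ i < l n, G.Step (γ n i) (γ n (i + 1)))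
    (hinj : ∀ n, Set.InjOn (γ n) (Set.Iic (l n)))
    (hdisj : ∀ n n', ∀ i ≤ l n, ∀ j ≤ l n', γ n i = γ n' j → n = n')
    (h0 : ∀ n, γ n 0 ∉ G.idSet) (hl : ∀ n, γ n (l n) ∈ G.idSet) :
    G.IdMatchable ((G.idSet \ Set.range fun n => γ n (l n)) ∪ Set.range fun n => γ n 0) := by
  classical
  have hw : ∀ n i, ∃ w, i < l n → (γ n i, w) ∈ G.edges ∧ (γ n (i + 1), w) ∈ G.idMatching := by
    intro n i
    by_cases hi : i < l n
    · obtain ⟨w, h⟩ := hstep n i hi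
      exact ⟨w, fun _ => h⟩
    · obtain ⟨e, -, -⟩ := hl n
      exact ⟨e.2, fun h => absurd h hi⟩
  choose ω hω' using hw
  have hωE : ∀ n, ∀ i < l n, (γ n i, ω n i) ∈ G.edges := fun n i hi => (hω' n i hi).1
  have hω : ∀ n, ∀ i < l n, (γ n (i + 1), ω n i) ∈ G.idMatching := fun n i hi => (hω' n i hi).2
  have hpos : ∀ n, 0 < l n := fun n => by
    rcases Nat.eq_zero_or_pos (l n) with h | h
    · exact absurd (h ▸ hl n) (h0 n)
    · exact h
  have heq : ∀ {n n' i j}, i ≤ l n → j ≤ l n' → γ n i = γ n' j → n = n' ∧ i = j := by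
    intro n n' i j hi hj h
    obtain rfl := hdisj n n' i hi j hj h
    exact ⟨rfl, hinj n hi hj h⟩
  have hωeq : ∀ {n n' i j}, i < l n → j < l n' → ω n i = ω n' j → n = n' ∧ i = j := by
    intro n n' i j hi hj h
    have h1 := hω n' j hj
    rw [← h] at h1
    obtain ⟨h2, h3⟩ := heq hi hj (idMatching_left_unique (hω n i hi) h1)
    exact ⟨h2, Nat.succ_injective h3⟩
  let T : Set V := {x | ∃ n, ∃ i ≤ l n, x = γ n i}
  let m : Set (V × W) := {e | ∃ n, ∃ i < l n, e = (γ n i, ω n i)} ∪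
    {e | e ∈ G.idMatching ∧ e.1 ∉ T}
  -- Whether an edge of the identity matching belongs to a path can be seen at either end.
  have hid : ∀ {x w n i}, (x, w) ∈ G.idMatching → i < l n → (w = ω n i ↔ x = γ n (i + 1)) := by
    intro x w n i h hi
    constructor
    · rintro rfl
      exact idMatching_left_unique h (hω n i hi)
    · rintro rfl
      exact idMatching_right_unique h (hω n i hi)
  have hidT : ∀ {x w}, (x, w) ∈ G.idMatching → x ∈ T →
      ∃ n, ∃ i < l n, x = γ n (i + 1) ∧ w = ω n i := by
    rintro x w h ⟨n, i, hi, rfl⟩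
    cases i with
    | zero => exact absurd ⟨_, h, rfl⟩ (h0 n)
    | succ i => exact ⟨n, i, hi, rfl, (hid h hi).2 rfl⟩
  have hidT' : ∀ {x n i}, (x, ω n i) ∈ G.idMatching → i < l n → x ∈ T :=
    fun {_ n i} h hi => ⟨n, i + 1, hi, (hid h hi).1 rfl⟩
  refine ⟨m, ⟨⟨?_, ?_⟩, ?_⟩, ?_⟩
  · rintro e (⟨n, i, hi, rfl⟩ | ⟨he, -⟩)
    · exact hωE n i hi
    · exact G.idMatching_subset he
  · rintro e (⟨n, i, hi, rfl⟩ | ⟨he, heT⟩) e' (⟨n', i', hi', rfl⟩ | ⟨he', heT'⟩) h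
    · obtain ⟨rfl, rfl⟩ : n = n' ∧ i = i' :=
        h.elim (fun h => heq hi.le hi'.le h) fun h => hωeq hi hi' h
      rfl
    · rcases h with h | h
      · exact absurd ⟨n, i, hi.le, h.symm⟩ heT'
      · refine absurd (hidT' (n := n) (i := i) ?_ hi) heT'
        have h' : ω n i = e'.2 := h
        rw [h']
        exact he'
    · rcases h with h | h
      · exact absurd ⟨n', i', hi'.le, h⟩ heT
      · refine absurd (hidT' (n := n') (i := i') ?_ hi') heT
        have h' : e.2 = ω n' i' := h
        rw [← h']
        exact he
    · exact G.idMatching_noShared e he e' he' h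
  · refine bipartiteGraph_supp_finite ?_
    have hblock : ∀ n, ∃ S : Set (V ⊕ W), S.Finite ∧ (∀ i ≤ l n, Sum.inl (γ n i) ∈ S) ∧
        (∀ i < l n, Sum.inr (ω n i) ∈ S) ∧
        ∀ x w, (x, w) ∈ G.idMatching ∪ m → (Sum.inl x ∈ S ↔ Sum.inr w ∈ S) := by
      intro n
      refine ⟨Sum.inl '' (γ n '' Set.Iic (l n)) ∪ Sum.inr '' (ω n '' Set.Iio (l n)),
        (((Set.finite_Iic _).image _).image _).union (((Set.finite_Iio _).image _).image _),
        fun i hi => .inl ⟨_, ⟨i, hi, rfl⟩, rfl⟩, fun i hi => .inr ⟨_, ⟨i, hi, rfl⟩, rfl⟩, ?_⟩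
      intro x w hxw
      have hx : (Sum.inl x : V ⊕ W) ∈ Sum.inl '' (γ n '' Set.Iic (l n)) ∪
          Sum.inr '' (ω n '' Set.Iio (l n)) ↔ ∃ i ≤ l n, γ n i = x := by
        simp
      have hw : (Sum.inr w : V ⊕ W) ∈ Sum.inl '' (γ n '' Set.Iic (l n)) ∪
          Sum.inr '' (ω n '' Set.Iio (l n)) ↔ ∃ i < l n, ω n i = w := by
        simp
      rw [hx, hw]
      have hidcase : (x, w) ∈ G.idMatching →
          ((∃ i ≤ l n, γ n i = x) ↔ ∃ i < l n, ω n i = w) := by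
        intro h
        constructor
        · rintro ⟨i, hi, rfl⟩
          obtain ⟨n', i', hi', h1, h2⟩ := hidT h ⟨n, i, hi, rfl⟩
          obtain ⟨rfl, -⟩ := heq hi hi' h1
          exact ⟨i', hi', h2.symm⟩
        · rintro ⟨i, hi, rfl⟩
          exact ⟨i + 1, hi, ((hid h hi).1 rfl).symm⟩
      rcases hxw with h | ⟨n', i', hi', he⟩ | ⟨h, -⟩
      · exact hidcase h
      · obtain ⟨rfl, rfl⟩ := Prod.mk.inj he
        constructor
        · rintro ⟨i, hi, h⟩
          obtain ⟨rfl, rfl⟩ := heq hi hi'.le h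
          exact ⟨i, hi', rfl⟩
        · rintro ⟨i, hi, h⟩
          obtain ⟨rfl, rfl⟩ := hωeq hi hi' h
          exact ⟨i, hi.le, rfl⟩
      · exact hidcase h
    have hpair : ∀ x w, (x, w) ∈ G.idMatching → x ∉ T → ∃ S : Set (V ⊕ W), S.Finite ∧
        Sum.inl x ∈ S ∧ Sum.inr w ∈ S ∧
        ∀ x' w', (x', w') ∈ G.idMatching ∪ m → (Sum.inl x' ∈ S ↔ Sum.inr w' ∈ S) := by
      intro x w h hT
      refine ⟨{Sum.inl x, Sum.inr w}, by simp, by simp, by simp, fun x' w' h' => ?_⟩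
      simp only [Set.mem_insert_iff, Set.mem_singleton_iff, Sum.inl.injEq, Sum.inr.injEq,
        reduceCtorEq, or_false, false_or]
      have hidcase : (x', w') ∈ G.idMatching → (x' = x ↔ w' = w) := fun h' =>
        ⟨fun hx => idMatching_right_unique (hx ▸ h') h, fun hw => idMatching_left_unique (hw ▸ h') h⟩
      rcases h' with h' | ⟨n, i, hi, he⟩ | ⟨h', -⟩
      · exact hidcase h'
      · obtain ⟨rfl, rfl⟩ := Prod.mk.inj he
        constructor
        · rintro rfl
          exact absurd ⟨n, i, hi.le, rfl⟩ hT
        · rintro rfl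
          exact absurd (hidT' h hi) hT
      · exact hidcase h'
    rintro (x | w)
    · by_cases hT : x ∈ T
      · obtain ⟨n, i, hi, rfl⟩ := hT
        obtain ⟨S, h1, h2, -, h4⟩ := hblock n
        exact ⟨S, h1, h2 i hi, h4⟩
      · by_cases hK : x ∈ G.idSet
        · obtain ⟨⟨x, w⟩, h, rfl⟩ := hK
          obtain ⟨S, h1, h2, -, h4⟩ := hpair x w h hT
          exact ⟨S, h1, h2, h4⟩
        · refine ⟨{Sum.inl x}, by simp, by simp, fun x' w' h' => ?_⟩
          simp only [Set.mem_singleton_iff, Sum.inl.injEq, reduceCtorEq, iff_false]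
          rintro rfl
          rcases h' with h' | ⟨n, i, hi, he⟩ | ⟨h', -⟩
          · exact hK ⟨_, h', rfl⟩
          · obtain ⟨rfl, rfl⟩ := Prod.mk.inj he
            exact hT ⟨n, i, hi.le, rfl⟩
          · exact hK ⟨_, h', rfl⟩
    · obtain ⟨x, h⟩ := G.exists_idMatching w
      by_cases hT : x ∈ T
      · obtain ⟨n, i, hi, -, rfl⟩ := hidT h hT
        obtain ⟨S, h1, -, h3, h4⟩ := hblock n
        exact ⟨S, h1, h3 i hi, h4⟩
      · obtain ⟨S, h1, -, h3, h4⟩ := hpair x w h hT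
        exact ⟨S, h1, h3, h4⟩
  · ext x
    constructor
    · rintro ⟨e, ⟨n, i, hi, rfl⟩ | ⟨he, heT⟩, rfl⟩
      · cases i with
        | zero => exact .inr ⟨n, rfl⟩
        | succ i =>
          refine .inl ⟨⟨_, hω n i (by omega), rfl⟩, ?_⟩
          rintro ⟨n', h⟩
          obtain ⟨rfl, h'⟩ := heq le_rfl hi.le h
          omega
      · refine .inl ⟨⟨e, he, rfl⟩, ?_⟩
        rintro ⟨n, h⟩
        exact heT ⟨n, l n, le_rfl, h.symm⟩
    · rintro (⟨⟨⟨x, w⟩, he, rfl⟩, hx⟩ | ⟨n, rfl⟩)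
      · by_cases hT : x ∈ T
        · obtain ⟨n, i, hi, rfl⟩ := hT
          have hne : i ≠ l n := by
            rintro rfl
            exact hx ⟨n, rfl⟩
          exact ⟨_, .inl ⟨n, i, by omega, rfl⟩, rfl⟩
        · exact ⟨_, .inr ⟨he, hT⟩, rfl⟩
      · exact ⟨_, .inl ⟨n, 0, hpos n, rfl⟩, rfl⟩

theorem idMatchable_idSet (G : Bimaze V W) : G.IdMatchable G.idSet := by
  have h := idMatchable_of_walks (G := G) (ι := Empty) (fun _ => 0) (fun n => n.elim) (by simp) (by simp)
    (by simp) (by simp) (by simp)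
  simpa only [Set.range_eq_empty, Set.sdiff_empty, Set.union_empty] using h

theorem idMatchable_of_reachable {u k : V} (hu : u ∉ G.idSet) (hk : k ∈ G.idSet)
    (h : Relation.ReflTransGen G.Step u k) : G.IdMatchable (insert u (G.idSet \ {k})) := by
  obtain ⟨l, γ, rfl, rfl, hs, hi⟩ := h.exists_injOn
  have h := idMatchable_of_walks (G := G) (ι := Unit) (fun _ => l) (fun _ => γ) (fun _ => hs)
    (fun _ => hi) (fun _ _ _ _ _ _ _ => rfl) (fun _ => hu) fun _ => hk
  simpa [Set.range_const] using h

/-- If the exchanges of `k i` for `u i` are possible one by one, but not those of `k i` for `u j`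
with `j < i`, then all of them are possible at the same time: a common vertex of the alternating
paths from `u i` to `k i` and from `u j` to `k j` would give a path from `u j` to `k i`. -/
theorem idMatchable_exchange {ι : Type*} [LinearOrder ι] {u k : ι → V} (hu : ∀ i, u i ∉ G.idSet)
    (hk : ∀ i, k i ∈ G.idSet) (h1 : ∀ i, G.IdMatchable (insert (u i) (G.idSet \ {k i})))
    (h2 : ∀ i j, j < i → ¬ G.IdMatchable (insert (u j) (G.idSet \ {k i}))) :
    G.IdMatchable ((G.idSet \ Set.range k) ∪ Set.range u) := by
  have hreach : ∀ i, Relation.ReflTransGen G.Step (u i) (k i) := by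
    intro i
    obtain ⟨x, ⟨hxK, hx⟩, h⟩ := (h1 i).exists_reachable (Set.mem_insert _ _) (hu i)
    have : x = k i := by
      by_contra hne
      exact hx (.inr ⟨hxK, hne⟩)
    exact this ▸ h
  choose l γ hγ0 hγl hs hi using fun i => (hreach i).exists_injOn
  have hfrom : ∀ n, ∀ i ≤ l n, Relation.ReflTransGen G.Step (u n) (γ n i) := by
    intro n i
    induction i with
    | zero => intro _; rw [hγ0]
    | succ i ih => exact fun h => (ih (by omega)).tail (hs n i h)
  have hto : ∀ n, ∀ j i, i + j = l n → Relation.ReflTransGen G.Step (γ n i) (k n) := by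
    intro n j
    induction j with
    | zero =>
      intro i hil
      rw [← hγl n, ← hil]
      exact .refl
    | succ j ih => exact fun i h => .head (hs n i (by omega)) (ih (i + 1) (by omega))
  have hne : ∀ n n', n < n' → ∀ i ≤ l n, ∀ j ≤ l n', γ n i ≠ γ n' j := by
    intro n n' hn i hi j hj h
    refine h2 n' n hn (idMatchable_of_reachable (hu n) (hk n') ((hfrom n i hi).trans ?_))
    rw [h]
    exact hto n' (l n' - j) j (by omega)
  have h := idMatchable_of_walks (G := G) l γ hs hi ?_ (fun n => hγ0 n ▸ hu n)
    fun n => hγl n ▸ hk n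
  · simpa only [hγ0, hγl] using h
  · intro n n' i hi j hj h
    rcases lt_trichotomy n n' with hn | hn | hn
    · exact absurd h (hne n n' hn i hi j hj)
    · exact hn
    · exact absurd h.symm (hne n' n hn j hj i hi)

end Bimaze

/-! ### The tree as a rooted tree -/

theorem SimpleGraph.IsTree.exists_parentTree {V : Type*} {T : SimpleGraph V} (hT : T.IsTree)
    (r : V) : ∃ R : ParentTree V, (∀ v, R.depth v = T.dist r v) ∧
      (∀ v w, R.Child v w ↔ w ∈ T.children r v) ∧
      ∀ v w, T.Adj v w ↔ R.Child v w ∨ R.Child w v := by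
  choose p hpath hlen using fun v => hT.connected.exists_path_of_dist r v
  have hnil : ∀ v, v ≠ r → ¬ (p v).Nil := fun v hv h => hv h.eq.symm
  have hadj : ∀ v, v ≠ r → T.Adj (p v).penultimate v := fun v hv => (p v).adj_penultimate (hnil v hv)
  have hdist : ∀ v, v ≠ r → T.dist r v = T.dist r (p v).penultimate + 1 := by
    intro v hv
    have h1 := (hadj v hv).diff_dist_adj (u := r)
    have h2 := hT.dist_ne_of_adj r (hadj v hv)
    have h3 := SimpleGraph.dist_le (p v).dropLast
    have h4 : (p v).dropLast.length + 1 = (p v).length :=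
      SimpleGraph.Walk.length_dropLast_add_one (hnil v hv)
    rw [hlen v] at h4
    omega
  -- The shortest path to `v`, extended by an edge from `v` to `w`, is the path to `w`.
  have hparent : ∀ v w, T.Adj v w → T.dist r w = T.dist r v + 1 → (p w).penultimate = v := by
    intro v w h hd
    have h1 : ((p v).concat h).IsPath := by
      refine SimpleGraph.Walk.isPath_of_length_eq_dist _ ?_
      rw [SimpleGraph.Walk.length_concat, hlen, hd]
    have h2 : p w = (p v).concat h :=
      congrArg Subtype.val ((hT.isAcyclic.subsingleton_path r w).elim ⟨p w, hpath w⟩ ⟨_, h1⟩)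
    rw [h2, SimpleGraph.Walk.penultimate_concat]
  let R : ParentTree V := ⟨r, fun v => (p v).penultimate, T.dist r, SimpleGraph.dist_self, hdist⟩
  have hchild : ∀ v w, R.Child v w ↔ w ∈ T.children r v := by
    intro v w
    constructor
    · rintro ⟨hw, rfl⟩
      exact ⟨hadj w hw, hdist w hw⟩
    · rintro ⟨h, hd⟩
      refine ⟨?_, hparent v w h hd⟩
      intro hw
      rw [show w = r from hw, SimpleGraph.dist_self] at hd
      omega
  refine ⟨R, fun _ => rfl, hchild, fun v w => ?_⟩
  rw [hchild, hchild]
  constructor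
  · intro h
    have h1 := h.diff_dist_adj (u := r)
    have h2 := hT.dist_ne_of_adj r h
    rcases h1 with h1 | h1 | h1
    · exact absurd h1.symm h2
    · exact .inl ⟨h, h1⟩
    · refine .inr ⟨h.symm, ?_⟩
      omega
  · rintro (h | h)
    · exact h.1
    · exact h.1.symm

/-- All paths of the dimaze of the tree have one or two vertices. -/
theorem SimpleGraph.treeDimaze_linkable_iff {V : Type*} {T : SimpleGraph V} {r : V}
    {R : ParentTree V} (hd : ∀ v, R.depth v = T.dist r v)
    (hadj : ∀ v w, T.Adj v w ↔ R.Child v w ∨ R.Child w v) (A : Set V) :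
    (T.treeDimaze r).Linkable A ↔ MatchableAlong R.Link A := by
  classical
  have heven : ∀ v, v ∈ T.evenLevels r ↔ Even (R.depth v) := fun v => by rw [hd]; exact Iff.rfl
  constructor
  · rintro ⟨Ps, ⟨hter, hdisj⟩, rfl⟩
    have hex : ∀ v, ∃ P, v ∈ Dimaze.Path.ini '' Ps → P ∈ Ps ∧ Dimaze.Path.ini P = v := by
      intro v
      by_cases h : v ∈ Dimaze.Path.ini '' Ps
      · obtain ⟨P, h1, h2⟩ := h
        exact ⟨P, fun _ => ⟨h1, h2⟩⟩
      · exact ⟨⟨[v], by simp, by simp, by simp⟩, fun h' => absurd h' h⟩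
    choose P hP using hex
    refine ⟨fun v => (P v).ter, ?_, ?_⟩
    · intro v hv v' hv' h
      have h1 : P v = P v' := by
        by_contra hne
        refine Set.disjoint_left.1 (hdisj (hP v hv).1 (hP v' hv').1 hne)
          (List.getLast_mem (P v).ne_nil) ?_
        change (P v).ter ∈ (P v').verts
        rw [show (P v).ter = (P v').ter from h]
        exact List.getLast_mem (P v').ne_nil
      rw [← (hP v hv).2, ← (hP v' hv').2, h1]
    · intro v hv
      obtain ⟨hPv, hini⟩ := hP v hv
      have ht := hter _ hPv
      change (_ → (P v).ter = v) ∧ (_ → R.Child v (P v).ter ∨ R.Child (P v).ter v)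
      generalize P v = Q at hini ht ⊢
      obtain ⟨l, hne, hch, hnd⟩ := Q
      match l, hne, hch, hnd, hini, ht with
      | [a], _, _, _, hini, ht =>
        obtain rfl : a = v := hini
        exact ⟨fun _ => rfl, fun h => absurd ((heven a).1 ht) h⟩
      | [a, b], _, hch, _, hini, _ =>
        obtain rfl : a = v := hini
        simp only [List.isChain_cons_cons, List.isChain_singleton, and_true] at hch
        obtain ⟨h1, h2, -⟩ := hch
        exact ⟨fun h => absurd ((heven a).2 h) h2, fun _ => (hadj a b).1 h1⟩
      | a :: b :: c :: l, _, hch, _, _, _ =>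
        simp only [List.isChain_cons_cons] at hch
        exact absurd hch.1.2.2 hch.2.1.2.1
  · rintro ⟨f, hf, hP⟩
    have hex : ∀ v, ∃ P : (T.treeDimaze r).Path, v ∈ A → P.ini = v ∧ P.ter = f v ∧
        ∀ x ∈ P.verts, x = v ∨ x = f v := by
      intro v
      by_cases hv : v ∈ A
      swap
      · exact ⟨⟨[v], by simp, by simp, by simp⟩, fun h => absurd h hv⟩
      by_cases he : Even (R.depth v)
      · exact ⟨⟨[v], by simp, by simp, by simp⟩, fun _ => ⟨rfl, ((hP v hv).1 he).symm, by simp⟩⟩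
      · have h1 : T.Adj v (f v) := (hadj _ _).2 ((hP v hv).2 he)
        have h2 : (T.treeDimaze r).digraph.Adj v (f v) :=
          ⟨h1, fun h => he ((heven v).1 h), (heven _).2 (hP v hv).even⟩
        exact ⟨⟨[v, f v], by simp, by simpa using h2, by simpa using h1.ne⟩,
          fun _ => ⟨rfl, rfl, by simp⟩⟩
    choose P hPA using hex
    have hini : ∀ v ∈ A, (P v).ini = v := fun v hv => (hPA v hv).1
    have hter : ∀ v ∈ A, (P v).ter = f v := fun v hv => (hPA v hv).2.1
    have hmem : ∀ v ∈ A, ∀ x ∈ (P v).verts, x = v ∨ x = f v := fun v hv => (hPA v hv).2.2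
    refine ⟨P '' A, ⟨?_, ?_⟩, ?_⟩
    · rintro _ ⟨v, hv, rfl⟩
      rw [hter v hv]
      exact (heven _).2 (hP v hv).even
    · have key : ∀ v ∈ A, ∀ v' ∈ A, v = f v' → v = v' := by
        intro v hv v' hv' h
        refine hf hv hv' ?_
        rw [← h]
        exact (hP v hv).1 (h ▸ (hP v' hv').even)
      rintro _ ⟨v, hv, rfl⟩ _ ⟨v', hv', rfl⟩ hne
      refine Set.disjoint_left.2 fun x hx hx' => hne (congrArg P ?_)
      rcases hmem v hv x hx with rfl | rfl <;> rcases hmem v' hv' _ hx' with h | h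
      · exact h
      · exact key _ hv _ hv' h
      · exact (key _ hv' _ hv h.symm).symm
      · exact hf hv hv' h
    · rw [Set.image_image]
      exact (Set.image_congr hini).trans (Set.image_id' A)

/-! ### The dual of the matroid of the tree -/

theorem Matroid.IsBase.dual_indep_exchange_iff {α : Type*} {M : Matroid α} {U : Set α}
    (hU : M.IsBase U) (hE : M.E = Set.univ) {b k : α} (hb : b ∈ U) (hk : k ∉ U) :
    M✶.Indep (insert b (Uᶜ \ {k})) ↔ M.Indep (insert k (U \ {b})) := by
  have hsub : insert b (Uᶜ \ {k}) ⊆ M.E := by rw [hE]; exact Set.subset_univ _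
  rw [Matroid.dual_indep_iff_exists hsub]
  constructor
  · rintro ⟨B, hB, hdisj⟩
    have hBk : ∀ x ∈ B, x ∉ U → x = k := by
      intro x hx hxU
      by_contra hne
      exact Set.disjoint_left.1 hdisj (.inr ⟨hxU, hne⟩) hx
    have hbB : b ∈ U \ B := ⟨hb, fun h => Set.disjoint_left.1 hdisj (.inl rfl) h⟩
    have hcard := hB.encard_sdiff_comm hU
    have h1 : (B \ U).encard ≤ 1 := Set.encard_le_one_iff.2 fun x y hx hy => by
      rw [hBk x hx.1 hx.2, hBk y hy.1 hy.2]
    have h2 : ∀ x ∈ U \ B, x = b := fun x hx =>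
      Set.encard_le_one_iff.1 (hcard ▸ h1) x b hx hbB
    have h3 : (B \ U).Nonempty := by
      rw [← Set.encard_pos, hcard, Set.encard_pos]
      exact ⟨b, hbB⟩
    obtain ⟨x, hx⟩ := h3
    refine hB.indep.subset (Set.insert_subset (hBk x hx.1 hx.2 ▸ hx.1) ?_)
    rintro y ⟨hyU, hyb⟩
    by_contra hyB
    exact hyb (h2 y ⟨hyU, hyB⟩)
  · intro h
    refine ⟨_, hU.exchange_isBase_of_indep hk h, Set.disjoint_left.2 ?_⟩
    rintro x (rfl | ⟨hx, hxk⟩) (rfl | ⟨hx', hxb⟩)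
    · exact hk hb
    · exact hxb rfl
    · exact hxk rfl
    · exact hx hx'

/-- A base of a path-transversal dual can be exchanged along all of an alternating ray at the same
time, whereas in the tree this leaves the root unspanned. -/
theorem ParentTree.matroid_dual_not_isPathTransversal {V : Type u} (R : ParentTree V)
    (hch : ∀ v, {w | R.Child v w}.Infinite) :
    ¬ Matroid.IsPathTransversal.{u, v, w} R.matroid.dual := by
  rintro ⟨V', W, G, e, he⟩
  have hE : R.matroid.E = Set.univ := rfl
  let τ : V' ≃ V := e.symm.trans (Equiv.subtypeUnivEquiv fun x => by
    rw [Matroid.dual_ground, hE]; trivial)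
  have hτ : ∀ I : Set V', R.matroid✶.Indep (τ '' I) ↔ G.IdMatchable I := by
    intro I
    have h := he (e.symm '' I)
    rw [Set.image_image, Set.image_image] at h
    simp only [Equiv.apply_symm_apply, Set.image_id'] at h
    exact h
  have hτs : ∀ I : Set V, R.matroid✶.Indep I ↔ G.IdMatchable (τ.symm '' I) := by
    intro I
    rw [← hτ, Set.image_image]
    simp
  set U : Set V := (τ '' G.idSet)ᶜ with hUdef
  have hUc : Uᶜ = τ '' G.idSet := compl_compl _
  have hKmem : ∀ x, τ.symm x ∈ G.idSet ↔ x ∉ U := by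
    intro x
    rw [hUdef, Set.mem_compl_iff, not_not, Equiv.image_eq_preimage_symm, Set.mem_preimage]
  have hK : R.matroid✶.IsBase (τ '' G.idSet) := by
    rw [Matroid.isBase_iff_maximal_indep]
    refine ⟨(hτ _).2 G.idMatchable_idSet, fun J hJ hKJ x hx => ?_⟩
    by_contra hxK
    have hxK' : τ.symm x ∉ G.idSet := fun h => hxK ⟨_, h, by simp⟩
    obtain ⟨k, ⟨hkK, hkJ⟩, -⟩ :=
      ((hτs J).1 hJ).exists_reachable (Set.mem_image_of_mem _ hx) hxK'
    exact hkJ ⟨τ k, hKJ ⟨k, hkK, rfl⟩, by simp⟩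
  have hU : R.matroid.IsBase U := by
    have h := (Matroid.dual_isBase_iff (M := R.matroid) (by rw [hE]; exact Set.subset_univ _)).1 hK
    rwa [hE, ← Set.compl_eq_univ_sdiff] at h
  have hUmax : Maximal (MatchableAlong R.Link) U := hU
  obtain ⟨f, hf, hP⟩ := hUmax.prop
  obtain ⟨r⟩ := ParentTree.exists_alternatingRay hUmax hf hP fun v x => by
    obtain ⟨w, hw, hwx⟩ := ((hch v).sdiff (Set.finite_singleton x)).nonempty
    exact ⟨w, hw, hwx⟩
  let N := {n | r.b n ∈ U}
  have hkU : ∀ n, r.entering n ∉ U := fun n => ParentTree.AlternatingRay.entering_notMem hf hP n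
  have hex : ∀ i j : N, G.IdMatchable (insert (τ.symm (r.b i)) (G.idSet \ {τ.symm (r.entering j)})) ↔
      MatchableAlong R.Link (insert (r.entering j) (U \ {r.b i})) := by
    intro i j
    refine Iff.trans ?_ (hU.dual_indep_exchange_iff hE i.2 (hkU j))
    rw [← hτ, Set.image_insert_eq, Set.image_sdiff τ.injective, Set.image_singleton,
      Equiv.apply_symm_apply, Equiv.apply_symm_apply, hUc]
  have hmatch := Bimaze.idMatchable_exchange (G := G) (ι := N) (u := fun i => τ.symm (r.b i))
    (k := fun i => τ.symm (r.entering i)) (fun i h => (hKmem _).1 h i.2)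
    (fun i => (hKmem _).2 (hkU i)) (fun i => (hex i i).2 (r.exchange_matchable hf hP i.2))
    fun i j hji h => r.not_exchange_matchable hUmax hf hP i.2 hji ((hex j i).1 h)
  rw [← hτ, Matroid.dual_indep_iff_exists (by rw [hE]; exact Set.subset_univ _)] at hmatch
  obtain ⟨B, hB, hdisj⟩ := hmatch
  have hBsub : B ⊆ r.exchange := by
    intro x hx
    have hxn : τ.symm x ∉ (G.idSet \ Set.range fun i : N => τ.symm (r.entering i)) ∪
        Set.range fun i : N => τ.symm (r.b i) := fun h =>
      Set.disjoint_left.1 hdisj ⟨_, h, τ.apply_symm_apply x⟩ hx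
    by_cases hxU : x ∈ U
    · refine .inl ⟨hxU, ?_⟩
      rintro ⟨n, hn, rfl⟩
      exact hxn (.inr ⟨⟨n, hn⟩, rfl⟩)
    · refine .inr ?_
      by_contra hcon
      refine hxn (.inl ⟨(hKmem x).2 hxU, ?_⟩)
      rintro ⟨n, hn⟩
      exact hcon ⟨n, n.2, τ.symm.injective hn⟩
  have hBmax : Maximal (MatchableAlong R.Link) B := hB
  have hroot : R.root ∉ B := fun h =>
    ParentTree.AlternatingRay.root_notMem_exchange (r := r) hf hP (hBsub h)
  exact hroot (hBmax.le_of_ge (y := insert R.root B)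
    ((ParentTree.AlternatingRay.insert_root_exchange_matchable (r := r) hf hP).mono
      (Set.insert_subset_insert hBsub)) (Set.subset_insert _ _) (Set.mem_insert _ _))

theorem SimpleGraph.IsTree.exists_matroid_not_isPathTransversal {V : Type u} {T : SimpleGraph V}
    (hT : T.IsTree) (r : V) (hch : ∀ x : V, (T.children r x).Infinite) :
    ∃ M : Matroid V, (T.treeDimaze r).IsLinkabilityMatroid M ∧
      M.IsStrictGammoid ∧ ¬ Matroid.IsPathTransversal.{u, v, w} M.dual := by
  obtain ⟨R, hd, hc, hadj⟩ := hT.exists_parentTree r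
  have hind : ∀ I, R.matroid.Indep I ↔ (T.treeDimaze r).Linkable I :=
    fun I => (SimpleGraph.treeDimaze_linkable_iff hd hadj I).symm
  refine ⟨R.matroid, ⟨rfl, hind⟩, ⟨V, T.treeDimaze r, Equiv.Set.univ V, fun I => hind _⟩,
    R.matroid_dual_not_isPathTransversal fun v => ?_⟩
  have : {w | R.Child v w} = T.children r v := Set.ext fun w => hc v w
  rw [this]
  exact hch v

/-! ### A tree in which all vertices have infinitely many children -/

/-- The tree of finite sequences of natural numbers, rooted at the empty sequence: the children of
`l` are the sequences `n :: l`. -/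
def sequenceTree : SimpleGraph (List ℕ) where
  Adj l l' := (∃ n, l' = n :: l) ∨ ∃ n, l = n :: l'
  symm := ⟨fun _ _ h => h.symm⟩
  loopless := ⟨fun l h => by
    obtain ⟨n, h⟩ | ⟨n, h⟩ := h <;> simpa using congrArg List.length h⟩

theorem sequenceTree_isTree : sequenceTree.IsTree := by
  have hnil : ∀ l, sequenceTree.Reachable [] l := by
    intro l
    induction l with
    | nil => exact .refl _
    | cons n l ih => exact ih.trans (SimpleGraph.Adj.reachable (.inl ⟨n, rfl⟩))
  refine ⟨⟨fun l l' => (hnil l).symm.trans (hnil l')⟩, ?_⟩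
  -- Without the edge from `l` to `n :: l`, no walk leaves the extensions of `n :: l`.
  have key : ∀ n l, sequenceTree.IsBridge s(n :: l, l) := by
    intro n l
    rw [SimpleGraph.isBridge_iff]
    rintro ⟨p⟩
    have hp : ∀ {x y : List ℕ}, (sequenceTree.deleteEdges {s(n :: l, l)}).Walk x y →
        n :: l <:+ x → n :: l <:+ y := by
      intro x y p
      induction p with
      | nil => exact id
      | @cons x y _ h _ ih =>
        refine fun hx => ih ?_
        rw [SimpleGraph.deleteEdges_adj] at h
        obtain ⟨⟨m, rfl⟩ | ⟨m, rfl⟩, hne⟩ := h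
        · exact hx.trans (List.suffix_cons _ _)
        · rcases List.suffix_cons_iff.1 hx with h | h
          · obtain ⟨rfl, rfl⟩ := List.cons.inj h
            exact absurd rfl hne
          · exact h
    have := (hp p (List.suffix_refl _)).length_le
    simp at this
  rw [SimpleGraph.isAcyclic_iff_forall_adj_isBridge]
  rintro l l' (⟨n, rfl⟩ | ⟨n, rfl⟩)
  · rw [Sym2.eq_swap]
    exact key n l
  · exact key n l'

theorem sequenceTree_dist (l : List ℕ) : sequenceTree.dist [] l = l.length := by
  have hle : ∀ {x y : List ℕ} (p : sequenceTree.Walk x y), y.length ≤ x.length + p.length := by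
    intro x y p
    induction p with
    | nil => simp
    | @cons x y z h p ih =>
      have : y.length ≤ x.length + 1 := by
        obtain ⟨n, rfl⟩ | ⟨n, rfl⟩ := h <;> simp
        omega
      rw [SimpleGraph.Walk.length_cons]
      omega
  have hge : ∀ l : List ℕ, ∃ p : sequenceTree.Walk l [], p.length = l.length := by
    intro l
    induction l with
    | nil => exact ⟨.nil, rfl⟩
    | cons n l ih =>
      obtain ⟨p, hp⟩ := ih
      have h : sequenceTree.Adj (n :: l) l := .inr ⟨n, rfl⟩
      exact ⟨.cons h p, by rw [SimpleGraph.Walk.length_cons, hp, List.length_cons]⟩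
  obtain ⟨p, hp⟩ := sequenceTree_isTree.connected.exists_walk_length_eq_dist [] l
  obtain ⟨q, hq⟩ := hge l
  have h1 := hle p
  have h2 := SimpleGraph.dist_le q
  rw [SimpleGraph.dist_comm] at h2
  simp only [List.length_nil] at h1
  omega

theorem sequenceTree_children_infinite (l : List ℕ) : (sequenceTree.children [] l).Infinite := by
  refine Set.infinite_of_injective_forall_mem (f := fun n : ℕ => n :: l)
    (fun m n h => (List.cons.inj h).1) fun n => ⟨.inl ⟨n, rfl⟩, ?_⟩
  rw [sequenceTree_dist, sequenceTree_dist, List.length_cons]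

theorem mainTheorem8 :
    (∀ (V : Type u) (T : SimpleGraph V) (r : V), T.IsTree →
      (∀ x : V, (T.children r x).Infinite) →
      ∃ M : Matroid V, (T.treeDimaze r).IsLinkabilityMatroid M ∧
        M.IsStrictGammoid ∧ ¬ Matroid.IsPathTransversal.{u, v, w} M.dual) ∧
    (∃ (α : Type) (M : Matroid α),
      M.IsStrictGammoid ∧ ¬ Matroid.IsPathTransversal.{0, v, w} M.dual) := by
  refine ⟨fun V T r hT hch => hT.exists_matroid_not_isPathTransversal r hch, ?_⟩
  obtain ⟨M, -, h1, h2⟩ := sequenceTree_isTree.exists_matroid_not_isPathTransversal []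
    sequenceTree_children_infinite
  exact ⟨List ℕ, M, h1, h2⟩
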